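/- Let $t^{1/4}\in\mathbb C^{\ast}$. \emph{Skein category.} For $m,n\ge 0$ let $\mathrm{Hom}_{\mathcal S}(m,n)$ be the complex vector space spanned by the planar isotopy classes (rel boundary) of $(m,n)$-tangle diagrams in the annulus $A=\{1\le|z|\le 2\}$ with endpoints $e^{2\pi i(j-1)/m}$ ($1\le j\le m$) and $2e^{2\pi i(j-1)/n}$ ($1\le j\le n$), modulo the local relations: a contractible loop is removed at the cost of the factor $-(t^{1/2}+t^{-1/2})$, and a diagram with a chosen crossing equals $t^{1/4}D'+t^{-1/4}D''$, where $D'$ (resp. $D''$) is the smoothing that joins the two regions swept out by turning the upper strand clockwise (resp. counterclockwise). Composition $[D']\circ[D]$ puts $D$ inside $D'$, and $\mathbf 1_n$ is the identity. For a $(k,l)$-diagram $D$ and an $(m,n)$-diagram $D'$ let $[D]\times_{\mathcal S}[D']=[D\ast D']\in\mathrm{Hom}_{\mathcal S}(k+m,l+n)$, where $D\ast D'$ is obtained by moving the endpoints of $D$ to the first $k$ (resp. $l$) marked points and those of $D'$ to the last $m$ (resp. $n$) marked points, without moving any of them across a radial segment just clockwise of the positive real axis, and placing $D$ on top of $D'$.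 Put $\mathcal I(Y)=Y\times_{\mathcal S}\mathbf 1_1$. \emph{Link pattern tower with twist weight $v=1$.} Let $X\in\mathrm{End}_{\mathcal S}(0)$ be the class of a simple loop around the hole and $\rho\in\mathrm{End}_{\mathcal S}(1)$ the class of an arc that winds once counterclockwise while running outwards. For $n\ge 0$ let $\overline n\in\{0,1\}$ be its residue modulo two and let $V_n$ be the quotient of $\mathrm{Hom}_{\mathcal S}(\overline n,n)$ by all $Y\circ X-(t^{1/4}+t^{-1/4})Y$ if $n$ is even, and by all $Y\circ\rho-Y$ if $n$ is odd; it is a left $\mathrm{End}_{\mathcal S}(n)$-module by composition. Write $\overline Y_n\in V_n$ for the class of $Y$. Let $U=t^{1/4}[c_+]+[c_-]\in\mathrm{Hom}_{\mathcal S}(0,2)$, where $c_+$ (resp. $c_-$) is the simple arc parallel to the counterclockwise boundary arc from the outer point $1$ to the outer point $2$ (resp. from $2$ to $1$). Then the following hold. (a) There are unique linear maps $\phi_n:V_n\to V_{n+1}$ ($n\ge 0$) with $\phi_n(\overline Y_n)=\overline{\mathcal I(Y)}_{n+1}$ for even $n$ and $\phi_n(\overline Y_n)=\overline{(\mathcal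 I(Y)\circ U)}_{n+1}$ for odd $n$ and $\phi_n(a\,y)=\mathcal I(a)\,\phi_n(y)$ for $a\in\mathrm{End}_{\mathcal S}(n)$, $y\in V_n$. (These are the connecting maps of the link pattern tower.) (b) There is a unique bilinear product on $\mathcal A=\bigoplus_{n\ge 0}V_n$ with $\overline Y_m\cdot\overline Z_n=\overline{(Y\times_{\mathcal S}Z)}_{m+n}$ if $m$ or $n$ is even and $\overline Y_m\cdot\overline Z_n=\overline{((Y\times_{\mathcal S}Z)\circ U)}_{m+n}$ if $m$ and $n$ are odd. It makes $\mathcal A$ a graded associative algebra whose unit is the class in $V_0$ of the empty diagram. (c) For all $n\ge 0$ and $y\in V_n$, in $\mathcal A$, $$\phi_n(y)=y\cdot\overline{\mathbf 1}_1 ,$$ where $\overline{\mathbf 1}_1\in V_1$ is the class of $\mathbf 1_1\in\mathrm{End}_{\mathcal S}(1)$. -/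

import Mathlib

/-!
Tangle diagrams in the annulus `A = {1 ≤ |z| ≤ 2}`, the Kauffman skein category of the annulus with
its tensor product, the link pattern modules, and the conditions that define the connecting maps of
the link pattern tower and the product on the direct sum of its representation spaces.
-/

namespace AnnularSkein

/-- The elementary pieces of a tangle diagram, read radially outwards. `Piece r s` has `r` endpoints
on its inner side and `s` on its outer side.

* `cup` creates two neighbouring strands (local minimum of the radius);
* `cap` joins two neighbouring strands (local maximum of the radius);
* `xover` is the crossing of neighbouring strands `i, i+1` whose upper strand runs from the inner
  position `i` to the outer position `i+1`;
* `xunder` is the crossing whose upper strand runs from the inner position `i+1` to the outer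
  position `i`. -/
inductive Piece : ℕ → ℕ → Type
  | cup : Piece 0 2
  | cap : Piece 2 0
  | xover : Piece 2 2
  | xunder : Piece 2 2

/-- A thin annular layer of a tangle diagram with `m` inner and `n` outer endpoints. The endpoints on
a circle are numbered counterclockwise, starting from the positive real axis.

* `place a p b` is the piece `p`, preceded (in the counterclockwise numbering) by `a` and followed by
  `b` radial strands;
* `rot` turns `k + 1 ≥ 1` strands counterclockwise by one position: the inner point `j` is joined to
  the outer point `j + 1`, and the last inner point to the first outer point;
* `rotInv` is the clockwise turn. -/
inductive Layer (m n : ℕ) : Type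
  | place {r s : ℕ} (a : ℕ) (p : Piece r s) (b : ℕ) (hm : m = a + r + b) (hn : n = a + s + b)
  | rot (k : ℕ) (hm : m = k + 1) (hn : n = k + 1)
  | rotInv (k : ℕ) (hm : m = k + 1) (hn : n = k + 1)

/-- An `(l, n)`-tangle diagram in the annulus, in general position with respect to the radius: a
finite sequence of layers, listed from the inner to the outer boundary (`snoc D e` adds the layer `e`
on the outside of `D`). Every tangle diagram has this form after a planar isotopy. There is none if
`l + n` is odd. -/
inductive Diagram (l : ℕ) : ℕ → Type
  | straight : Diagram l l
  | snoc {m n : ℕ} (D : Diagram l m) (e : Layer m n) : Diagram l n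

namespace Diagram

/-- `E.comp D` is `E ∘ D`: the diagram `D` is put inside `E`. -/
def comp {l m n : ℕ} : Diagram m n → Diagram l m → Diagram l n
  | straight, D => D
  | snoc E e, D => snoc (E.comp D) e

/-- The diagram with one layer. -/
def one {m n : ℕ} (e : Layer m n) : Diagram m n := snoc straight e

/-- The diagram with two layers, `e` inside `f`. -/
def two {m k n : ℕ} (e : Layer m k) (f : Layer k n) : Diagram m n := snoc (snoc straight e) f

/-- The counterclockwise turn of `n` strands by `k` positions. -/
def turn : (k n : ℕ) → k ≤ n → Diagram n n
  | 0, _, _ => straight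
  | k + 1, n, h =>
      snoc (turn k n (by omega)) (.rot (n - 1) (by omega) (by omega))

end Diagram

open Diagram Layer

/-- The elementary planar isotopies of tangle diagrams in the annulus (rel boundary). No Reidemeister
move occurs among them. Two diagrams are planar isotopic if and only if they are related by a finite
sequence of these moves, applied to consecutive layers. -/
inductive Move : {m n : ℕ} → Diagram m n → Diagram m n → Prop
  /-- Two pieces at disjoint places are passed through each other's radius. -/
  | exchange {m k k' n r s r' s' : ℕ} (a c b : ℕ) (p : Piece r s) (p' : Piece r' s')
      (h₁ : m = a + r + (c + r' + b)) (h₂ : k = a + s + (c + r' + b))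
      (h₃ : k = a + s + c + r' + b) (h₄ : n = a + s + c + s' + b)
      (h₅ : m = a + r + c + r' + b) (h₆ : k' = a + r + c + s' + b)
      (h₇ : k' = a + r + (c + s' + b)) (h₈ : n = a + s + (c + s' + b)) :
      Move (two (place (m := m) (n := k) a p (c + r' + b) h₁ h₂)
              (place (n := n) (a + s + c) p' b h₃ h₄))
        (two (place (m := m) (n := k') (a + r + c) p' b h₅ h₆)
              (place (n := n) a p (c + s' + b) h₇ h₈))
  /-- A bend of a strand is straightened. -/
  | zigzag {m k : ℕ} (a b : ℕ) (h₁ : m = a + 1 + 0 + b) (h₂ : k = a + 1 + 2 + b)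
      (h₃ : k = a + 2 + (b + 1)) (h₄ : m = a + 0 + (b + 1)) :
      Move (two (place (m := m) (n := k) (a + 1) .cup b h₁ h₂)
              (place (n := m) a .cap (b + 1) h₃ h₄)) straight
  /-- The mirror image of the previous move. -/
  | zagzig {m k : ℕ} (a b : ℕ) (h₁ : m = a + 0 + (b + 1)) (h₂ : k = a + 2 + (b + 1))
      (h₃ : k = a + 1 + 2 + b) (h₄ : m = a + 1 + 0 + b) :
      Move (two (place (m := m) (n := k) a .cup (b + 1) h₁ h₂)
              (place (n := m) (a + 1) .cap b h₃ h₄)) straight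
  /-- A crossing is turned by a right angle at a cap (lower strand bent). -/
  | capOver {m n : ℕ} (a b : ℕ) (h₁ : m = a + 1 + 2 + b) (h₂ : m = a + 2 + (b + 1))
      (h₃ : n = a + 0 + (b + 1)) (h₄ : n = a + 1 + 0 + b) :
      Move (two (place (m := m) (n := m) (a + 1) .xover b h₁ h₁)
              (place (n := n) a .cap (b + 1) h₂ h₃))
        (two (place (m := m) (n := m) a .xunder (b + 1) h₂ h₂)
              (place (n := n) (a + 1) .cap b h₁ h₄))
  /-- A crossing is turned by a right angle at a cap (upper strand bent). -/
  | capUnder {m n : ℕ} (a b : ℕ) (h₁ : m = a + 1 + 2 + b) (h₂ : m = a + 2 + (b + 1))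
      (h₃ : n = a + 0 + (b + 1)) (h₄ : n = a + 1 + 0 + b) :
      Move (two (place (m := m) (n := m) (a + 1) .xunder b h₁ h₁)
              (place (n := n) a .cap (b + 1) h₂ h₃))
        (two (place (m := m) (n := m) a .xover (b + 1) h₂ h₂)
              (place (n := n) (a + 1) .cap b h₁ h₄))
  /-- A crossing is turned by a right angle at a cup (upper strand bent). -/
  | cupOver {m n : ℕ} (a b : ℕ) (h₁ : n = a + 1 + 2 + b) (h₂ : n = a + 2 + (b + 1))
      (h₃ : m = a + 0 + (b + 1)) (h₄ : m = a + 1 + 0 + b) :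
      Move (two (place (m := m) (n := n) a .cup (b + 1) h₃ h₂)
              (place (n := n) (a + 1) .xover b h₁ h₁))
        (two (place (m := m) (n := n) (a + 1) .cup b h₄ h₁)
              (place (n := n) a .xunder (b + 1) h₂ h₂))
  /-- A crossing is turned by a right angle at a cup (lower strand bent). -/
  | cupUnder {m n : ℕ} (a b : ℕ) (h₁ : n = a + 1 + 2 + b) (h₂ : n = a + 2 + (b + 1))
      (h₃ : m = a + 0 + (b + 1)) (h₄ : m = a + 1 + 0 + b) :
      Move (two (place (m := m) (n := n) a .cup (b + 1) h₃ h₂)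
              (place (n := n) (a + 1) .xunder b h₁ h₁))
        (two (place (m := m) (n := n) (a + 1) .cup b h₄ h₁)
              (place (n := n) a .xover (b + 1) h₂ h₂))
  /-- A counterclockwise and a clockwise turn cancel. -/
  | rot_rotInv {m : ℕ} (k : ℕ) (h : m = k + 1) :
      Move (two (rot (m := m) (n := m) k h h) (rotInv (n := m) k h h)) straight
  | rotInv_rot {m : ℕ} (k : ℕ) (h : m = k + 1) :
      Move (two (rotInv (m := m) (n := m) k h h) (rot (n := m) k h h)) straight
  /-- A piece is passed through a turn that does not carry it across the positive real axis. -/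
  | place_rot {m n r s : ℕ} (a b : ℕ) (p : Piece r s)
      (h₁ : m = a + r + (b + 1)) (h₂ : n = a + s + (b + 1))
      (h₃ : n = a + s + b + 1) (h₄ : m = a + r + b + 1)
      (h₅ : m = a + 1 + r + b) (h₆ : n = a + 1 + s + b) :
      Move (two (place (m := m) (n := n) a p (b + 1) h₁ h₂) (rot (n := n) (a + s + b) h₃ h₃))
        (two (rot (m := m) (n := m) (a + r + b) h₄ h₄) (place (n := n) (a + 1) p b h₅ h₆))
  /-- The piece in the last place is turned across the positive real axis into the first place. -/
  | wrap {m n r s : ℕ} (a : ℕ) (p : Piece r s) (h₁ : m = a + r + 0) (h₂ : n = a + s + 0)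
      (h₃ : m = 0 + r + a) (h₄ : n = 0 + s + a) :
      Move ((turn s n (by omega)).comp (Diagram.one (place (m := m) (n := n) a p 0 h₁ h₂)))
        ((Diagram.one (place (m := m) (n := n) 0 p a h₃ h₄)).comp (turn r m (by omega)))

/-- The local relations of the skein category; `q` stands for `t^{1/4}`. -/
inductive LocalRel (q : ℂˣ) : {m n : ℕ} → (Diagram m n →₀ ℂ) → Prop
  /-- Planar isotopic diagrams are identified. -/
  | isotopy {m n : ℕ} {D D' : Diagram m n} (h : Move D D') :
      LocalRel q (Finsupp.single D 1 - Finsupp.single D' 1)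
  /-- The Kauffman skein relation at a crossing of type `xover`. -/
  | xover {m k : ℕ} (a b : ℕ) (h : m = a + 2 + b) (h' : k = a + 0 + b) :
      LocalRel q (Finsupp.single (.one (place (m := m) (n := m) a .xover b h h)) 1
        - (Finsupp.single straight (q : ℂ)
          + Finsupp.single (two (place (m := m) (n := k) a .cap b h h')
              (place (n := m) a .cup b h' h)) (q : ℂ)⁻¹))
  /-- The Kauffman skein relation at a crossing of type `xunder`. -/
  | xunder {m k : ℕ} (a b : ℕ) (h : m = a + 2 + b) (h' : k = a + 0 + b) :
      LocalRel q (Finsupp.single (.one (place (m := m) (n := m) a .xunder b h h)) 1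
        - (Finsupp.single (two (place (m := m) (n := k) a .cap b h h')
              (place (n := m) a .cup b h' h)) (q : ℂ)
          + Finsupp.single straight (q : ℂ)⁻¹))
  /-- Removal of a contractible loop. -/
  | loop {m k : ℕ} (a b : ℕ) (h : m = a + 0 + b) (h' : k = a + 2 + b) :
      LocalRel q (Finsupp.single (two (place (m := m) (n := k) a .cup b h h')
              (place (n := m) a .cap b h' h)) 1
        - Finsupp.single straight (-((q : ℂ) ^ 2 + ((q : ℂ)⁻¹) ^ 2)))

/-- All relations between `(l, n)`-diagrams: a local relation, surrounded by a diagram `O` on the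
outside and containing a diagram `I` on the inside. -/
noncomputable def skeinRel (q : ℂˣ) (l n : ℕ) : Submodule ℂ (Diagram l n →₀ ℂ) :=
  Submodule.span ℂ {x | ∃ (m k : ℕ) (O : Diagram k n) (I : Diagram l m) (y : Diagram m k →₀ ℂ),
    LocalRel q y ∧ x = Finsupp.mapDomain (fun D => (O.comp D).comp I) y}

/-- The morphism space `Hom_S(m, n)` of the skein category of the annulus. -/
abbrev Skein (q : ℂˣ) (m n : ℕ) : Type := (Diagram m n →₀ ℂ) ⧸ skeinRel q m n

namespace Skein

variable {q : ℂˣ}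

/-- The skein class `[D]` of a tangle diagram. -/
noncomputable def mk (q : ℂˣ) {m n : ℕ} (D : Diagram m n) : Skein q m n :=
  Submodule.Quotient.mk (Finsupp.single D 1)

/-- The class of the identity diagram `Id_n`. -/
noncomputable def one (q : ℂˣ) (n : ℕ) : Skein q n n := mk q Diagram.straight

theorem comp_id {m n : ℕ} (D : Diagram m n) : D.comp Diagram.straight = D := by
  induction D with
  | straight => rfl
  | snoc D e ih => simp [Diagram.comp, ih]

theorem comp_assoc' {k l m n : ℕ} (F : Diagram m n) (E : Diagram l m) (D : Diagram k l) :
    (F.comp E).comp D = F.comp (E.comp D) := by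
  induction F with
  | straight => rfl
  | snoc F e ih => simp [Diagram.comp, ih]

theorem ext_mk {m n : ℕ} {M : Type*} [AddCommGroup M] [Module ℂ M] {f g : Skein q m n →ₗ[ℂ] M}
    (h : ∀ D, f (mk q D) = g (mk q D)) : f = g := by
  apply Submodule.linearMap_qext
  apply Finsupp.lhom_ext'
  intro D
  apply LinearMap.ext_ring
  exact h D

/-- A linear map on the free space that kills the relations descends to `Hom_S(m, n)`. -/
theorem rel_le_ker {l n : ℕ} {M : Type*} [AddCommGroup M] [Module ℂ M]
    (f : (Diagram l n →₀ ℂ) →ₗ[ℂ] M)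
    (h : ∀ (m k : ℕ) (O : Diagram k n) (I : Diagram l m) (y : Diagram m k →₀ ℂ), LocalRel q y →
      f (Finsupp.mapDomain (fun D => (O.comp D).comp I) y) = 0) :
    skeinRel q l n ≤ LinearMap.ker f := by
  refine Submodule.span_le.2 ?_
  rintro x ⟨m, k, O, I, y, hy, rfl⟩
  exact h m k O I y hy

theorem mkQ_rel {l m k n : ℕ} (O : Diagram k n) (I : Diagram l m) {y : Diagram m k →₀ ℂ}
    (hy : LocalRel q y) :
    (skeinRel q l n).mkQ (Finsupp.mapDomain (fun D => (O.comp D).comp I) y) = 0 := by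
  rw [Submodule.mkQ_apply, Submodule.Quotient.mk_eq_zero]
  exact Submodule.subset_span ⟨m, k, O, I, y, hy, rfl⟩

/-- `E ∘ -` on skein classes, for a diagram `E`. -/
noncomputable def post (q : ℂˣ) {l m n : ℕ} (E : Diagram m n) : Skein q l m →ₗ[ℂ] Skein q l n :=
  Submodule.liftQ _ ((skeinRel q l n).mkQ ∘ₗ Finsupp.lmapDomain ℂ ℂ (fun D => E.comp D))
    (rel_le_ker _ fun m k O I y hy => by
      have := mkQ_rel (E.comp O) I hy
      simp only [LinearMap.comp_apply, Finsupp.lmapDomain_apply, ← Finsupp.mapDomain_comp]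
      simpa only [Function.comp_def, comp_assoc'] using this)

theorem post_mk {l m n : ℕ} (E : Diagram m n) (D : Diagram l m) :
    post q E (mk q D) = mk q (E.comp D) := by
  rw [post, mk, Submodule.liftQ_apply]
  simp [mk]

/-- The composition `Y ∘ Z` in the skein category, `[E] ∘ [D] = [E ∘ D]`, as a bilinear map. -/
noncomputable def comp {l m n : ℕ} : Skein q m n →ₗ[ℂ] Skein q l m →ₗ[ℂ] Skein q l n :=
  Submodule.liftQ _ (Finsupp.lift (Skein q l m →ₗ[ℂ] Skein q l n) ℂ (Diagram m n) (post q))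
    (rel_le_ker _ fun m k O I y hy => by
      apply ext_mk
      intro D
      have h := mkQ_rel O (I.comp D) hy
      rw [LinearMap.zero_apply, ← h]
      clear h hy
      induction y using Finsupp.induction_linear with
      | zero => simp
      | add f g hf hg => simp only [Finsupp.mapDomain_add, map_add, LinearMap.add_apply, hf, hg]
      | single E c =>
        simp only [Finsupp.mapDomain_single, Finsupp.lift_apply, Finsupp.sum_single_index,
          zero_smul, LinearMap.smul_apply, post_mk, comp_assoc']
        simp only [mk, ← Submodule.mkQ_apply, ← map_smul, Finsupp.smul_single, smul_eq_mul, mul_one])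

theorem comp_mk {l m n : ℕ} (E : Diagram m n) (D : Diagram l m) :
    comp (mk q E) (mk q D) = mk q (E.comp D) := by
  rw [← post_mk]
  congr 1
  simp [comp, mk, Submodule.liftQ_apply]

theorem comp_one {m n : ℕ} (Y : Skein q m n) : comp Y (one q m) = Y := by
  have : (comp (q := q)).flip (one q m) = (LinearMap.id : Skein q m n →ₗ[ℂ] _) :=
    ext_mk fun D => by simp [one, comp_mk, comp_id]
  exact LinearMap.congr_fun this Y

theorem one_comp {m n : ℕ} (Y : Skein q m n) : comp (one q n) Y = Y := by
  have : comp (one q n) = (LinearMap.id : Skein q m n →ₗ[ℂ] _) :=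
    ext_mk fun D => by simp only [one, comp_mk]; rfl
  exact LinearMap.congr_fun this Y

theorem comp_assoc {k l m n : ℕ} (W : Skein q m n) (Y : Skein q l m) (Z : Skein q k l) :
    comp (comp W Y) Z = comp W (comp Y Z) := by
  have h1 : ∀ (F : Diagram m n) (E : Diagram l m),
      comp (comp (mk q F) (mk q E)) = (comp (mk q F)) ∘ₗ (comp (l := k) (mk q E)) :=
    fun F E => ext_mk fun D => by simp [comp_mk, comp_assoc']
  have h2 : ∀ F : Diagram m n, (comp.flip Z) ∘ₗ comp (l := l) (mk q F)
      = (comp (mk q F)) ∘ₗ (comp.flip Z) :=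
    fun F => ext_mk fun E => by simpa using LinearMap.congr_fun (h1 F E) Z
  have h3 : (comp.flip Z) ∘ₗ (comp.flip Y) = (comp (q := q) (n := n)).flip (comp Y Z) :=
    ext_mk fun F => by simpa using LinearMap.congr_fun (h2 F) Y
  exact LinearMap.congr_fun h3 W

/-! The relations between layers, as equations in the skein category. -/

/-- The class of a single layer. -/
noncomputable def ly (q : ℂˣ) {m n : ℕ} (e : Layer m n) : Skein q m n := mk q (.one e)

theorem mk_snoc {l m n : ℕ} (D : Diagram l m) (e : Layer m n) :
    mk q (snoc D e) = comp (ly q e) (mk q D) := by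
  rw [ly, comp_mk]; rfl

theorem mk_two {m k n : ℕ} (e : Layer m k) (f : Layer k n) :
    mk q (two e f) = comp (ly q f) (ly q e) := mk_snoc _ _

theorem mkQ_local {m n : ℕ} {y : Diagram m n →₀ ℂ} (hy : LocalRel q y) :
    (skeinRel q m n).mkQ y = 0 := by
  have := mkQ_rel straight straight hy
  have h : (fun D : Diagram m n => ((straight : Diagram n n).comp D).comp straight) = _root_.id :=
    funext fun D => by rw [comp_id]; rfl
  rwa [h, Finsupp.mapDomain_id] at this

theorem mkQ_single {m n : ℕ} (D : Diagram m n) (c : ℂ) :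
    (skeinRel q m n).mkQ (Finsupp.single D c) = c • mk q D := by
  rw [mk, ← Submodule.mkQ_apply, ← map_smul, Finsupp.smul_single, smul_eq_mul, mul_one]

theorem mk_move {m n : ℕ} {D D' : Diagram m n} (h : Move D D') : mk q D = mk q D' := by
  have := mkQ_local (.isotopy (q := q) h)
  simpa [map_sub, mkQ_single, sub_eq_zero, -Submodule.mkQ_apply] using this

theorem ly_over {m k : ℕ} (a b : ℕ) (h : m = a + 2 + b) (h' : k = a + 0 + b) :
    ly q (place (m := m) (n := m) a .xover b h h) = (q : ℂ) • one q m
      + (q : ℂ)⁻¹ • comp (ly q (place a .cup b h' h)) (ly q (place a .cap b h h')) := by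
  have := mkQ_local (.xover (q := q) a b h h')
  rw [map_sub, map_add, mkQ_single, mkQ_single, mkQ_single, sub_eq_zero, one_smul, mk_two] at this
  exact this

theorem ly_under {m k : ℕ} (a b : ℕ) (h : m = a + 2 + b) (h' : k = a + 0 + b) :
    ly q (place (m := m) (n := m) a .xunder b h h) = (q : ℂ)⁻¹ • one q m
      + (q : ℂ) • comp (ly q (place a .cup b h' h)) (ly q (place a .cap b h h')) := by
  have := mkQ_local (.xunder (q := q) a b h h')
  rw [map_sub, map_add, mkQ_single, mkQ_single, mkQ_single, sub_eq_zero, one_smul, mk_two,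
    add_comm] at this
  exact this

theorem ly_loop {m k : ℕ} (a b : ℕ) (h : m = a + 0 + b) (h' : k = a + 2 + b) :
    comp (ly q (place a .cap b h' h)) (ly q (place a .cup b h h'))
      = (-((q : ℂ) ^ 2 + ((q : ℂ)⁻¹) ^ 2)) • one q m := by
  have := mkQ_local (.loop (q := q) a b h h')
  rw [map_sub, mkQ_single, mkQ_single, sub_eq_zero, one_smul, mk_two] at this
  exact this

theorem over_under {m : ℕ} (a b : ℕ) (h : m = a + 2 + b) :
    comp (ly q (place a .xover b h h)) (ly q (place a .xunder b h h)) = one q m := by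
  have hq : (q : ℂ) ≠ 0 := q.ne_zero
  rw [ly_over a b h rfl, ly_under a b h rfl]
  simp only [map_add, map_smul, LinearMap.add_apply, LinearMap.smul_apply, one_comp, comp_one]
  rw [comp_assoc, ← comp_assoc (ly q (place a .cap b h rfl)), ly_loop, map_smul,
    LinearMap.smul_apply, one_comp]
  simp only [map_smul]
  match_scalars <;> field_simp <;> ring

theorem under_over {m : ℕ} (a b : ℕ) (h : m = a + 2 + b) :
    comp (ly q (place a .xunder b h h)) (ly q (place a .xover b h h)) = one q m := by
  have hq : (q : ℂ) ≠ 0 := q.ne_zero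
  rw [ly_over a b h rfl, ly_under a b h rfl]
  simp only [map_add, map_smul, LinearMap.add_apply, LinearMap.smul_apply, one_comp, comp_one]
  rw [comp_assoc, ← comp_assoc (ly q (place a .cap b h rfl)), ly_loop, map_smul,
    LinearMap.smul_apply, one_comp]
  simp only [map_smul]
  match_scalars <;> field_simp <;> ring

theorem cup_slide {m n : ℕ} (a b : ℕ) (p : Piece 2 2) (h₁ : n = a + 1 + 2 + b)
    (h₂ : n = a + 2 + (b + 1)) (h₃ : m = a + 0 + (b + 1)) (h₄ : m = a + 1 + 0 + b) :
    comp (ly q (place a p (b + 1) h₂ h₂)) (comp (ly q (place (a + 1) p b h₁ h₁))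
      (ly q (place a .cup (b + 1) h₃ h₂))) = ly q (place (a + 1) .cup b h₄ h₁) := by
  cases p with
  | xover =>
    rw [← mk_two, mk_move (.cupOver a b h₁ h₂ h₃ h₄), mk_two, ← comp_assoc, over_under, one_comp]
  | xunder =>
    rw [← mk_two, mk_move (.cupUnder a b h₁ h₂ h₃ h₄), mk_two, ← comp_assoc, under_over, one_comp]

theorem cap_slide {m n : ℕ} (a b : ℕ) (p : Piece 2 2) (h₁ : m = a + 1 + 2 + b)
    (h₂ : m = a + 2 + (b + 1)) (h₃ : n = a + 0 + (b + 1)) (h₄ : n = a + 1 + 0 + b) :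
    comp (ly q (place (a + 1) .cap b h₁ h₄)) (comp (ly q (place a p (b + 1) h₂ h₂))
      (ly q (place (a + 1) p b h₁ h₁))) = ly q (place a .cap (b + 1) h₂ h₃) := by
  cases p with
  | xover =>
    rw [← comp_assoc, ← mk_two, ← mk_move (.capUnder a b h₁ h₂ h₃ h₄), mk_two, comp_assoc,
      under_over, comp_one]
  | xunder =>
    rw [← comp_assoc, ← mk_two, ← mk_move (.capOver a b h₁ h₂ h₃ h₄), mk_two, comp_assoc,
      over_under, comp_one]

theorem braid_aux {m k : ℕ} (a b : ℕ) (p : Piece 2 2) (h₁ : m = a + 1 + 2 + b)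
    (h₂ : m = a + 2 + (b + 1)) (h₃ : k = a + 0 + (b + 1)) (h₄ : k = a + 1 + 0 + b) :
    comp (ly q (place a p (b + 1) h₂ h₂)) (comp (ly q (place (a + 1) p b h₁ h₁))
      (comp (ly q (place a .cup (b + 1) h₃ h₂)) (ly q (place a .cap (b + 1) h₂ h₃))))
    = comp (comp (ly q (place (a + 1) .cup b h₄ h₁)) (ly q (place (a + 1) .cap b h₁ h₄)))
      (comp (ly q (place a p (b + 1) h₂ h₂)) (ly q (place (a + 1) p b h₁ h₁))) := by
  rw [comp_assoc (ly q (place (a + 1) .cup b h₄ h₁)), cap_slide a b p h₁ h₂ h₃ h₄,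
    ← comp_assoc (ly q (place (a + 1) p b h₁ h₁)), ← comp_assoc, cup_slide a b p h₁ h₂ h₃ h₄]

theorem braid {m : ℕ} (a b : ℕ) (p p' : Piece 2 2) (h₁ : m = a + 1 + 2 + b)
    (h₂ : m = a + 2 + (b + 1)) :
    comp (ly q (place a p (b + 1) h₂ h₂)) (comp (ly q (place (a + 1) p b h₁ h₁))
      (ly q (place a p' (b + 1) h₂ h₂)))
    = comp (ly q (place (a + 1) p' b h₁ h₁))
      (comp (ly q (place a p (b + 1) h₂ h₂)) (ly q (place (a + 1) p b h₁ h₁))) := by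
  have aux := braid_aux (q := q) a b p h₁ h₂ (k := a + 0 + (b + 1)) rfl (by omega)
  cases p' with
  | xover =>
    rw [ly_over a (b + 1) h₂ rfl, ly_over (k := a + 0 + (b + 1)) (a + 1) b h₁ (by omega)]
    simp only [map_add, map_smul, LinearMap.add_apply, LinearMap.smul_apply, one_comp, comp_one,
      aux]
  | xunder =>
    rw [ly_under a (b + 1) h₂ rfl, ly_under (k := a + 0 + (b + 1)) (a + 1) b h₁ (by omega)]
    simp only [map_add, map_smul, LinearMap.add_apply, LinearMap.smul_apply, one_comp, comp_one,
      aux]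

/-! Insertion of a strand, on diagrams. -/

end Skein

/-- One layer of the diagram `D ∗ Id₁`: a new last strand passes underneath all other strands. -/
def Layer.insR {m n : ℕ} : Layer m n → Diagram (m + 1) (n + 1)
  | place a p b hm hn => .one (place a p (b + 1) (by omega) (by omega))
  | rot k hm hn => two
      (place (n := m + 1) k .xover 0 (by omega) (by omega))
      (rot (k + 1) (by omega) (by omega))
  | rotInv k hm hn => two
      (rotInv (n := n + 1) (k + 1) (by omega) (by omega))
      (place k .xunder 0 (by omega) (by omega))

/-- One layer of the diagram `Id₁ ∗ D`: a new first strand passes above all other strands. -/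
def Layer.insL {m n : ℕ} : Layer m n → Diagram (m + 1) (n + 1)
  | place a p b hm hn => .one (place (a + 1) p b (by omega) (by omega))
  | rot k hm hn => two
      (rot (n := n + 1) (k + 1) (by omega) (by omega))
      (place 0 .xunder k (by omega) (by omega))
  | rotInv k hm hn => two
      (place (n := m + 1) 0 .xover k (by omega) (by omega))
      (rotInv (k + 1) (by omega) (by omega))

/-- The diagram `D ∗ Id₁`. -/
def Diagram.insR {m n : ℕ} : Diagram m n → Diagram (m + 1) (n + 1)
  | straight => straight
  | snoc D e => e.insR.comp D.insR

/-- The diagram `Id₁ ∗ D`. -/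
def Diagram.insL {m n : ℕ} : Diagram m n → Diagram (m + 1) (n + 1)
  | straight => straight
  | snoc D e => e.insL.comp D.insL

namespace Skein

variable {q : ℂˣ}

theorem insR_comp {l m n : ℕ} (E : Diagram m n) (D : Diagram l m) :
    (E.comp D).insR = E.insR.comp D.insR := by
  induction E with
  | straight => rfl
  | snoc E e ih => simp only [Diagram.comp, Diagram.insR, ih, comp_assoc']

theorem insL_comp {l m n : ℕ} (E : Diagram m n) (D : Diagram l m) :
    (E.comp D).insL = E.insL.comp D.insL := by
  induction E with
  | straight => rfl
  | snoc E e ih => simp only [Diagram.comp, Diagram.insL, ih, comp_assoc']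

/-- A composition-preserving operation on diagrams which respects the local relations descends to
skein classes. -/
theorem functor_ker (F : ∀ {m n : ℕ}, Diagram m n → Diagram (m + 1) (n + 1))
    (hF : ∀ {l m n : ℕ} (E : Diagram m n) (D : Diagram l m), F (E.comp D) = (F E).comp (F D))
    (h : ∀ {m n : ℕ} (y : Diagram m n →₀ ℂ), LocalRel q y →
      (skeinRel q (m + 1) (n + 1)).mkQ (Finsupp.mapDomain F y) = 0) (l n : ℕ) :
    skeinRel q l n ≤ LinearMap.ker
      ((skeinRel q (l + 1) (n + 1)).mkQ ∘ₗ Finsupp.lmapDomain ℂ ℂ (F (m := l) (n := n))) := by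
  refine rel_le_ker _ fun m k O I y hy => ?_
  have h0 := h y hy
  have key : ∀ z : Diagram m k →₀ ℂ, (skeinRel q (l + 1) (n + 1)).mkQ
      (Finsupp.mapDomain F (Finsupp.mapDomain (fun D => (O.comp D).comp I) z))
      = comp (comp (mk q (F O)) ((skeinRel q (m + 1) (k + 1)).mkQ (Finsupp.mapDomain F z)))
        (mk q (F I)) := by
    intro z
    induction z using Finsupp.induction_linear with
    | zero => simp only [Finsupp.mapDomain_zero, map_zero, LinearMap.zero_apply]
    | add f g hf hg => simp only [Finsupp.mapDomain_add, map_add, hf, hg, LinearMap.add_apply]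
    | single D c =>
      simp only [Finsupp.mapDomain_single, mkQ_single, map_smul, LinearMap.smul_apply, comp_mk, hF]
  rw [LinearMap.comp_apply, Finsupp.lmapDomain_apply, key, h0, map_zero, map_zero, LinearMap.zero_apply]

theorem ly_exchange {m k k' n r s r' s' : ℕ} (a c b : ℕ) (p : Piece r s) (p' : Piece r' s')
    (h₁ : m = a + r + (c + r' + b)) (h₂ : k = a + s + (c + r' + b))
    (h₃ : k = a + s + c + r' + b) (h₄ : n = a + s + c + s' + b)
    (h₅ : m = a + r + c + r' + b) (h₆ : k' = a + r + c + s' + b)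
    (h₇ : k' = a + r + (c + s' + b)) (h₈ : n = a + s + (c + s' + b)) :
    comp (ly q (place (a + s + c) p' b h₃ h₄)) (ly q (place a p (c + r' + b) h₁ h₂))
      = comp (ly q (place a p (c + s' + b) h₇ h₈)) (ly q (place (a + r + c) p' b h₅ h₆)) := by
  rw [← mk_two, ← mk_two]
  exact mk_move (.exchange a c b p p' h₁ h₂ h₃ h₄ h₅ h₆ h₇ h₈)

theorem ly_place_rot {m n r s : ℕ} (a b : ℕ) (p : Piece r s)
      (h₁ : m = a + r + (b + 1)) (h₂ : n = a + s + (b + 1))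
      (h₃ : n = a + s + b + 1) (h₄ : m = a + r + b + 1)
      (h₅ : m = a + 1 + r + b) (h₆ : n = a + 1 + s + b) :
    comp (ly q (rot (a + s + b) h₃ h₃)) (ly q (place a p (b + 1) h₁ h₂))
      = comp (ly q (place (a + 1) p b h₅ h₆)) (ly q (rot (a + r + b) h₄ h₄)) := by
  rw [← mk_two, ← mk_two]
  exact mk_move (.place_rot a b p h₁ h₂ h₃ h₄ h₅ h₆)

theorem wrap_cup {m n : ℕ} (a k : ℕ) (h₁ : m = a + 0 + 0) (h₂ : n = a + 2 + 0)
    (h₃ : m = 0 + 0 + a) (h₄ : n = 0 + 2 + a) (h₅ : n = k + 1) :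
    comp (ly q (rot k h₅ h₅)) (comp (ly q (rot k h₅ h₅)) (ly q (place a .cup 0 h₁ h₂)))
      = ly q (place 0 .cup a h₃ h₄) := by
  obtain rfl : k = n - 1 := by omega
  have := mk_move (q := q) (.wrap a .cup h₁ h₂ h₃ h₄)
  simpa only [turn, Diagram.comp, Diagram.one, mk_snoc, show mk q straight = one q m from rfl,
    comp_one] using this

theorem wrap_cap {m n : ℕ} (a k : ℕ) (h₁ : m = a + 2 + 0) (h₂ : n = a + 0 + 0)
    (h₃ : m = 0 + 2 + a) (h₄ : n = 0 + 0 + a) (h₅ : m = k + 1) :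
    ly q (place a .cap 0 h₁ h₂) = comp (ly q (place 0 .cap a h₃ h₄))
      (comp (ly q (rot k h₅ h₅)) (ly q (rot k h₅ h₅))) := by
  obtain rfl : k = m - 1 := by omega
  have := mk_move (q := q) (.wrap a .cap h₁ h₂ h₃ h₄)
  simpa only [turn, Diagram.comp, Diagram.one, mk_snoc, show mk q straight = one q m from rfl,
    comp_one] using this

theorem wrap_cross {m : ℕ} (a k : ℕ) (p : Piece 2 2) (h₁ : m = a + 2 + 0)
    (h₃ : m = 0 + 2 + a) (h₅ : m = k + 1) :
    comp (ly q (rot k h₅ h₅)) (comp (ly q (rot k h₅ h₅)) (ly q (place a p 0 h₁ h₁)))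
      = comp (ly q (place 0 p a h₃ h₃)) (comp (ly q (rot k h₅ h₅)) (ly q (rot k h₅ h₅))) := by
  obtain rfl : k = m - 1 := by omega
  have := mk_move (q := q) (.wrap a p h₁ h₁ h₃ h₃)
  simpa only [turn, Diagram.comp, Diagram.one, mk_snoc, show mk q straight = one q m from rfl,
    comp_one] using this

theorem rot_cancel {m : ℕ} (k : ℕ) (h : m = k + 1) :
    comp (ly q (rotInv k h h)) (ly q (rot k h h)) = one q m := by
  rw [← mk_two, mk_move (.rot_rotInv k h)]; rfl

theorem rotInv_cancel {m : ℕ} (k : ℕ) (h : m = k + 1) :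
    comp (ly q (rot k h h)) (ly q (rotInv k h h)) = one q m := by
  rw [← mk_two, mk_move (.rotInv_rot k h)]; rfl

theorem place_congr {m n r s : ℕ} {a a' b b' : ℕ} (p : Piece r s) (ha : a = a') (hb : b = b')
    (h₁ : m = a + r + b) (h₂ : n = a + s + b) (h₁' : m = a' + r + b') (h₂' : n = a' + s + b') :
    (place a p b h₁ h₂ : Layer m n) = place a' p b' h₁' h₂' := by
  subst ha hb; rfl

theorem rot_congr {m n : ℕ} {k k' : ℕ} (h₁ : m = k + 1) (h₂ : n = k + 1) (h₁' : m = k' + 1)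
    (h₂' : n = k' + 1) : (rot k h₁ h₂ : Layer m n) = rot k' h₁' h₂' := by
  obtain rfl : k = k' := by omega
  rfl

/-- A turn commutes with a crossing which it does not carry across the cut. -/
theorem cross_rot {m : ℕ} (a b k : ℕ) (p : Piece 2 2) (h₁ : m = a + 2 + (b + 1))
    (h₂ : m = a + 1 + 2 + b) (h : m = k + 1) :
    comp (ly q (rot k h h)) (ly q (place a p (b + 1) h₁ h₁))
      = comp (ly q (place (a + 1) p b h₂ h₂)) (ly q (rot k h h)) := by
  obtain rfl : k = a + 2 + b := by omega
  exact ly_place_rot a b p h₁ h₁ h h h₂ h₂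

/-- Turning the strands twice around while the last strand passes over (`insR` of a double turn). -/
theorem two_turns_R {m : ℕ} (a k : ℕ) (p : Piece 2 2) (h₁ : m = a + 1 + 2 + 0)
    (h₂ : m = a + 2 + (0 + 1)) (h : m = k + 1) {l : ℕ} (Y : Skein q l m) :
    comp (ly q (rot k h h)) (comp (ly q (place (a + 1) p 0 h₁ h₁))
      (comp (ly q (rot k h h)) (comp (ly q (place (a + 1) p 0 h₁ h₁)) Y)))
    = comp (ly q (rot k h h)) (comp (ly q (rot k h h)) (comp (ly q (place a p (0 + 1) h₂ h₂))
        (comp (ly q (place (a + 1) p 0 h₁ h₁)) Y))) := by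
  rw [← comp_assoc (ly q (place (a + 1) p 0 h₁ h₁)) (ly q (rot k h h)),
    ← cross_rot a 0 k p h₂ h₁ h, comp_assoc]

theorem two_turns_L {m : ℕ} (a k : ℕ) (p : Piece 2 2) (h₁ : m = 0 + 2 + (a + 1))
    (h₂ : m = 0 + 1 + 2 + a) (h : m = k + 1) {l : ℕ} (Y : Skein q l m) :
    comp (ly q (place 0 p (a + 1) h₁ h₁)) (comp (ly q (rot k h h))
      (comp (ly q (place 0 p (a + 1) h₁ h₁)) (comp (ly q (rot k h h)) Y)))
    = comp (ly q (place 0 p (a + 1) h₁ h₁)) (comp (ly q (place (0 + 1) p a h₂ h₂))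
        (comp (ly q (rot k h h)) (comp (ly q (rot k h h)) Y))) := by
  rw [← comp_assoc (ly q (rot k h h)) (ly q (place 0 p (a + 1) h₁ h₁)),
    cross_rot 0 a k p h₁ h₂ h, comp_assoc]

theorem wrapR_cup {m n : ℕ} (a j k : ℕ) (h₁ : m = a + 0 + (0 + 1)) (h₂ : n = a + 2 + (0 + 1))
    (h₃ : m = 0 + 0 + (a + 1)) (h₄ : n = 0 + 2 + (a + 1)) (h₅ : n = k + 1) (h₆ : n = j + 2 + 0) :
    comp (ly q (rot k h₅ h₅)) (comp (ly q (place j .xover 0 h₆ h₆)) (comp (ly q (rot k h₅ h₅))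
      (comp (ly q (place j .xover 0 h₆ h₆)) (ly q (place a .cup (0 + 1) h₁ h₂)))))
      = ly q (place 0 .cup (a + 1) h₃ h₄) := by
  obtain rfl : j = a + 1 := by omega
  rw [two_turns_R a k .xover h₆ h₂ h₅, cup_slide a 0 .xover h₆ h₂ h₁ h₁,
    wrap_cup (a + 1) k h₁ h₆ h₃ h₄ h₅]

theorem wrapR_cap {m n : ℕ} (a j k : ℕ) (h₁ : m = a + 2 + (0 + 1)) (h₂ : n = a + 0 + (0 + 1))
    (h₃ : m = 0 + 2 + (a + 1)) (h₄ : n = 0 + 0 + (a + 1)) (h₅ : m = k + 1) (h₆ : m = j + 2 + 0) :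
    ly q (place a .cap (0 + 1) h₁ h₂) = comp (ly q (place 0 .cap (a + 1) h₃ h₄))
      (comp (ly q (rot k h₅ h₅)) (comp (ly q (place j .xover 0 h₆ h₆)) (comp (ly q (rot k h₅ h₅))
      (ly q (place j .xover 0 h₆ h₆))))) := by
  obtain rfl : j = a + 1 := by omega
  have e := two_turns_R (q := q) a k .xover h₆ h₁ h₅ (one q m)
  simp only [comp_one] at e
  rw [e, ← cap_slide a 0 .xover h₆ h₁ h₂ h₂, wrap_cap (a + 1) k h₆ h₂ h₃ h₄ h₅]
  simp only [comp_assoc]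

theorem wrapR_cross {m : ℕ} (a j k : ℕ) (p : Piece 2 2) (h₁ : m = a + 2 + (0 + 1))
    (h₃ : m = 0 + 2 + (a + 1)) (h₅ : m = k + 1) (h₆ : m = j + 2 + 0) :
    comp (ly q (rot k h₅ h₅)) (comp (ly q (place j .xover 0 h₆ h₆)) (comp (ly q (rot k h₅ h₅))
      (comp (ly q (place j .xover 0 h₆ h₆)) (ly q (place a p (0 + 1) h₁ h₁)))))
    = comp (ly q (place 0 p (a + 1) h₃ h₃))
      (comp (ly q (rot k h₅ h₅)) (comp (ly q (place j .xover 0 h₆ h₆)) (comp (ly q (rot k h₅ h₅))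
      (ly q (place j .xover 0 h₆ h₆))))) := by
  obtain rfl : j = a + 1 := by omega
  have e := two_turns_R (q := q) a k .xover h₆ h₁ h₅ (one q m)
  simp only [comp_one] at e
  rw [two_turns_R a k .xover h₆ h₁ h₅, e, braid a 0 .xover p h₆ h₁]
  have w := wrap_cross (q := q) (a + 1) k p h₆ h₃ h₅
  rw [← comp_assoc (ly q (rot k h₅ h₅)) (ly q (place (a + 1) p 0 _ _)), ← comp_assoc, w]
  simp only [comp_assoc]

theorem wrapL_cup {m n : ℕ} (a j k : ℕ) (h₁ : m = a + 1 + 0 + 0) (h₂ : n = a + 1 + 2 + 0)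
    (h₃ : m = 0 + 1 + 0 + a) (h₄ : n = 0 + 1 + 2 + a) (h₅ : n = k + 1) (h₆ : n = 0 + 2 + j) :
    comp (ly q (place 0 .xunder j h₆ h₆)) (comp (ly q (rot k h₅ h₅))
      (comp (ly q (place 0 .xunder j h₆ h₆)) (comp (ly q (rot k h₅ h₅))
        (ly q (place (a + 1) .cup 0 h₁ h₂)))))
      = ly q (place (0 + 1) .cup a h₃ h₄) := by
  obtain rfl : j = a + 1 := by omega
  rw [two_turns_L a k .xunder h₆ h₄ h₅,
    wrap_cup (a + 1) k h₁ h₂ (by omega) h₆ h₅, cup_slide 0 a .xunder h₄ h₆ (by omega) h₃]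

theorem wrapL_cap {m n : ℕ} (a j k : ℕ) (h₁ : m = a + 1 + 2 + 0) (h₂ : n = a + 1 + 0 + 0)
    (h₃ : m = 0 + 1 + 2 + a) (h₄ : n = 0 + 1 + 0 + a) (h₅ : m = k + 1) (h₆ : m = 0 + 2 + j) :
    ly q (place (a + 1) .cap 0 h₁ h₂) = comp (ly q (place (0 + 1) .cap a h₃ h₄))
      (comp (ly q (place 0 .xunder j h₆ h₆)) (comp (ly q (rot k h₅ h₅))
      (comp (ly q (place 0 .xunder j h₆ h₆)) (ly q (rot k h₅ h₅))))) := by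
  obtain rfl : j = a + 1 := by omega
  have e := two_turns_L (q := q) a k .xunder h₆ h₃ h₅ (one q m)
  simp only [comp_one] at e
  rw [e, ← comp_assoc (ly q (place 0 .xunder (a + 1) h₆ h₆)), ← comp_assoc,
    cap_slide 0 a .xunder h₃ h₆ (by omega) h₄, wrap_cap (a + 1) k h₁ h₂ h₆ (by omega) h₅]

theorem wrapL_cross {m : ℕ} (a j k : ℕ) (p : Piece 2 2) (h₁ : m = a + 1 + 2 + 0)
    (h₃ : m = 0 + 1 + 2 + a) (h₅ : m = k + 1) (h₆ : m = 0 + 2 + j) :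
    comp (ly q (place 0 .xunder j h₆ h₆)) (comp (ly q (rot k h₅ h₅))
      (comp (ly q (place 0 .xunder j h₆ h₆)) (comp (ly q (rot k h₅ h₅))
        (ly q (place (a + 1) p 0 h₁ h₁)))))
    = comp (ly q (place (0 + 1) p a h₃ h₃))
      (comp (ly q (place 0 .xunder j h₆ h₆)) (comp (ly q (rot k h₅ h₅))
      (comp (ly q (place 0 .xunder j h₆ h₆)) (ly q (rot k h₅ h₅))))) := by
  obtain rfl : j = a + 1 := by omega
  have e := two_turns_L (q := q) a k .xunder h₆ h₃ h₅ (one q m)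
  simp only [comp_one] at e
  have b := braid (q := q) 0 a .xunder p h₃ h₆
  rw [two_turns_L a k .xunder h₆ h₃ h₅, e, wrap_cross (a + 1) k p h₁ h₆ h₅,
    ← comp_assoc (ly q (place (0 + 1) .xunder a h₃ h₃)), ← comp_assoc, b]
  simp only [comp_assoc]

theorem insR_wrap {m n r s : ℕ} (a : ℕ) (p : Piece r s) (h₁ : m = a + r + 0) (h₂ : n = a + s + 0)
    (h₃ : m = 0 + r + a) (h₄ : n = 0 + s + a) :
    mk q ((turn s n (by omega)).comp (Diagram.one (place (m := m) (n := n) a p 0 h₁ h₂))).insR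
      = mk q ((Diagram.one (place (m := m) (n := n) 0 p a h₃ h₄)).comp
        (turn r m (by omega))).insR := by
  cases p with
  | cup =>
    simp only [turn, Diagram.insR, Layer.insR, Diagram.comp, Diagram.one, two, mk_snoc,
      show ∀ n, mk q (straight : Diagram n n) = one q n from fun _ => rfl, comp_one]
    exact wrapR_cup a _ _ _ _ _ _ _ _
  | cap =>
    simp only [turn, Diagram.insR, Layer.insR, Diagram.comp, Diagram.one, two, mk_snoc,
      show ∀ n, mk q (straight : Diagram n n) = one q n from fun _ => rfl, comp_one]
    exact wrapR_cap a _ _ _ _ _ _ _ _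
  | xover =>
    obtain rfl : m = n := h₁.trans h₂.symm
    simp only [turn, Diagram.insR, Layer.insR, Diagram.comp, Diagram.one, two, mk_snoc,
      show ∀ n, mk q (straight : Diagram n n) = one q n from fun _ => rfl, comp_one]
    exact wrapR_cross a _ _ .xover _ _ _ _
  | xunder =>
    obtain rfl : m = n := h₁.trans h₂.symm
    simp only [turn, Diagram.insR, Layer.insR, Diagram.comp, Diagram.one, two, mk_snoc,
      show ∀ n, mk q (straight : Diagram n n) = one q n from fun _ => rfl, comp_one]
    exact wrapR_cross a _ _ .xunder _ _ _ _

theorem insR_place_rot {m n r s : ℕ} (a b : ℕ) (p : Piece r s)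
      (h₁ : m = a + r + (b + 1)) (h₂ : n = a + s + (b + 1))
      (h₃ : n = a + s + b + 1) (h₄ : m = a + r + b + 1)
      (h₅ : m = a + 1 + r + b) (h₆ : n = a + 1 + s + b) :
    mk q (two (place (m := m) (n := n) a p (b + 1) h₁ h₂) (rot (n := n) (a + s + b) h₃ h₃)).insR
      = mk q (two (rot (m := m) (n := m) (a + r + b) h₄ h₄)
          (place (n := n) (a + 1) p b h₅ h₆)).insR := by
  simp only [two, Diagram.insR, Layer.insR, Diagram.comp, Diagram.one, mk_snoc]
  rw [← comp_assoc (ly q (place (a + s + b) _ _ _ _))]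
  have e := ly_exchange (q := q) (m := m + 1) (k := n + 1) (k' := m + 1) (n := n + 1) a b 0 p
    .xover (by omega) (by omega) (by omega) (by omega) (by omega) (by omega) (by omega) (by omega)
  have e2 := ly_place_rot (q := q) (m := m + 1) (n := n + 1) a (b + 1) p (by omega) (by omega)
    (by omega) (by omega) (by omega) (by omega)
  refine (congrArg (comp (ly q (rot (a + s + b + 1) _ _)))
    (LinearMap.congr_fun (congrArg comp e) (mk q straight))).trans ?_
  rw [comp_assoc, ← comp_assoc (ly q (rot _ _ _))]
  refine (LinearMap.congr_fun (congrArg comp e2) _).trans ?_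
  rw [comp_assoc]
  rfl

theorem insL_wrap {m n r s : ℕ} (a : ℕ) (p : Piece r s) (h₁ : m = a + r + 0) (h₂ : n = a + s + 0)
    (h₃ : m = 0 + r + a) (h₄ : n = 0 + s + a) :
    mk q ((turn s n (by omega)).comp (Diagram.one (place (m := m) (n := n) a p 0 h₁ h₂))).insL
      = mk q ((Diagram.one (place (m := m) (n := n) 0 p a h₃ h₄)).comp
        (turn r m (by omega))).insL := by
  cases p with
  | cup =>
    simp only [turn, Diagram.insL, Layer.insL, Diagram.comp, Diagram.one, two, mk_snoc,
      show ∀ n, mk q (straight : Diagram n n) = one q n from fun _ => rfl, comp_one]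
    exact wrapL_cup a _ _ _ _ _ _ _ _
  | cap =>
    simp only [turn, Diagram.insL, Layer.insL, Diagram.comp, Diagram.one, two, mk_snoc,
      show ∀ n, mk q (straight : Diagram n n) = one q n from fun _ => rfl, comp_one]
    exact wrapL_cap a _ _ _ _ _ _ _ _
  | xover =>
    obtain rfl : m = n := h₁.trans h₂.symm
    simp only [turn, Diagram.insL, Layer.insL, Diagram.comp, Diagram.one, two, mk_snoc,
      show ∀ n, mk q (straight : Diagram n n) = one q n from fun _ => rfl, comp_one]
    exact wrapL_cross a _ _ .xover _ _ _ _
  | xunder =>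
    obtain rfl : m = n := h₁.trans h₂.symm
    simp only [turn, Diagram.insL, Layer.insL, Diagram.comp, Diagram.one, two, mk_snoc,
      show ∀ n, mk q (straight : Diagram n n) = one q n from fun _ => rfl, comp_one]
    exact wrapL_cross a _ _ .xunder _ _ _ _

theorem insL_place_rot {m n r s : ℕ} (a b : ℕ) (p : Piece r s)
      (h₁ : m = a + r + (b + 1)) (h₂ : n = a + s + (b + 1))
      (h₃ : n = a + s + b + 1) (h₄ : m = a + r + b + 1)
      (h₅ : m = a + 1 + r + b) (h₆ : n = a + 1 + s + b) :
    mk q (two (place (m := m) (n := n) a p (b + 1) h₁ h₂) (rot (n := n) (a + s + b) h₃ h₃)).insL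
      = mk q (two (rot (m := m) (n := m) (a + r + b) h₄ h₄)
          (place (n := n) (a + 1) p b h₅ h₆)).insL := by
  simp only [two, Diagram.insL, Layer.insL, Diagram.comp, Diagram.one, mk_snoc]
  have e := ly_exchange (q := q) (m := m + 1) (k := m + 1) (k' := n + 1) (n := n + 1) 0 a b
    .xunder p (by omega) (by omega) (by omega) (by omega) (by omega) (by omega) (by omega)
    (by omega)
  have e2 := ly_place_rot (q := q) (m := m + 1) (n := n + 1) (a + 1) b p (by omega) (by omega)
    (by omega) (by omega) (by omega) (by omega)
  rw [place_congr p (show a + 1 + 1 = 0 + 2 + a by omega) rfl _ _ (by omega) (by omega)]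
  rw [← comp_assoc (ly q (place (0 + 2 + a) _ _ _ _)), ← comp_assoc (ly q (rot _ _ _))]
  rw [rot_congr _ _ (show n + 1 = a + 1 + s + b + 1 by omega) (by omega),
    rot_congr _ _ (show m + 1 = a + 1 + r + b + 1 by omega) (by omega), e2,
    place_congr p (show a + 1 + 1 = 0 + 2 + a by omega) rfl _ _ (by omega) (by omega)]
  rw [e]
  simp only [comp_assoc]

theorem insR_move {m n : ℕ} {D D' : Diagram m n} (h : Move D D') :
    mk q D.insR = mk q D'.insR := by
  cases h with
  | exchange a c b p p' h₁ h₂ h₃ h₄ h₅ h₆ h₇ h₈ =>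
    exact mk_move (.exchange a c (b + 1) p p' _ _ _ _ _ _ _ _)
  | zigzag a b => exact mk_move (.zigzag a (b + 1) _ _ _ _)
  | zagzig a b => exact mk_move (.zagzig a (b + 1) _ _ _ _)
  | capOver a b => exact mk_move (.capOver a (b + 1) _ _ _ _)
  | capUnder a b => exact mk_move (.capUnder a (b + 1) _ _ _ _)
  | cupOver a b => exact mk_move (.cupOver a (b + 1) _ _ _ _)
  | cupUnder a b => exact mk_move (.cupUnder a (b + 1) _ _ _ _)
  | rot_rotInv k h =>
    simp only [two, Diagram.insR, Layer.insR, Diagram.comp, mk_snoc]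
    rw [← comp_assoc (ly q (rotInv _ _ _)), rot_cancel, one_comp, ← comp_assoc, under_over,
      one_comp]
  | rotInv_rot k h =>
    simp only [two, Diagram.insR, Layer.insR, Diagram.comp, mk_snoc]
    rw [← comp_assoc (ly q (place _ _ _ _ _)) (ly q (place _ _ _ _ _)), over_under, one_comp,
      ← comp_assoc, rotInv_cancel, one_comp]
  | place_rot a b p h₁ h₂ h₃ h₄ h₅ h₆ => exact insR_place_rot a b p h₁ h₂ h₃ h₄ h₅ h₆
  | wrap a p h₁ h₂ h₃ h₄ => exact insR_wrap a p h₁ h₂ h₃ h₄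

theorem insL_move {m n : ℕ} {D D' : Diagram m n} (h : Move D D') :
    mk q D.insL = mk q D'.insL := by
  cases h with
  | exchange a c b p p' h₁ h₂ h₃ h₄ h₅ h₆ h₇ h₈ =>
    rename_i k k' r s r' s'
    have e := ly_exchange (q := q) (m := m + 1) (k := k + 1) (k' := k' + 1) (n := n + 1) (a + 1) c
      b p p' (by omega) (by omega) (by omega) (by omega) (by omega) (by omega) (by omega)
      (by omega)
    simp only [two, Diagram.insL, Layer.insL, Diagram.comp, Diagram.one, mk_snoc]
    rw [place_congr p' (show a + s + c + 1 = a + 1 + s + c by omega) rfl _ _ (by omega) (by omega),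
      place_congr p' (show a + r + c + 1 = a + 1 + r + c by omega) rfl _ _ (by omega) (by omega),
      ← comp_assoc, e, comp_assoc]
  | zigzag a b => exact mk_move (.zigzag (a + 1) b _ _ _ _)
  | zagzig a b => exact mk_move (.zagzig (a + 1) b _ _ _ _)
  | capOver a b => exact mk_move (.capOver (a + 1) b _ _ _ _)
  | capUnder a b => exact mk_move (.capUnder (a + 1) b _ _ _ _)
  | cupOver a b => exact mk_move (.cupOver (a + 1) b _ _ _ _)
  | cupUnder a b => exact mk_move (.cupUnder (a + 1) b _ _ _ _)
  | rot_rotInv k h =>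
    simp only [two, Diagram.insL, Layer.insL, Diagram.comp, mk_snoc]
    rw [← comp_assoc (ly q (place _ _ _ _ _)) (ly q (place _ _ _ _ _)), over_under, one_comp,
      ← comp_assoc, rot_cancel, one_comp]
  | rotInv_rot k h =>
    simp only [two, Diagram.insL, Layer.insL, Diagram.comp, mk_snoc]
    rw [← comp_assoc (ly q (rot _ _ _)), rotInv_cancel, one_comp, ← comp_assoc, under_over,
      one_comp]
  | place_rot a b p h₁ h₂ h₃ h₄ h₅ h₆ => exact insL_place_rot a b p h₁ h₂ h₃ h₄ h₅ h₆
  | wrap a p h₁ h₂ h₃ h₄ => exact insL_wrap a p h₁ h₂ h₃ h₄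

theorem insR_local {m n : ℕ} (y : Diagram m n →₀ ℂ) (hy : LocalRel q y) :
    (skeinRel q (m + 1) (n + 1)).mkQ (Finsupp.mapDomain Diagram.insR y) = 0 := by
  cases hy with
  | isotopy h =>
    rw [← Finsupp.lmapDomain_apply ℂ ℂ]
    simp only [map_sub, Finsupp.lmapDomain_apply, Finsupp.mapDomain_single, mkQ_single, insR_move h,
      sub_self]
  | xover a b h h' =>
    rw [← Finsupp.lmapDomain_apply ℂ ℂ]
    subst h'
    simp only [map_sub, map_add, Finsupp.lmapDomain_apply, Finsupp.mapDomain_single, mkQ_single]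
    have := mkQ_local (.xover (q := q) a (b + 1) (m := m + 1) (k := a + 0 + b + 1) (by omega)
      (by omega))
    simp only [map_sub, map_add, mkQ_single] at this
    exact this
  | xunder a b h h' =>
    rw [← Finsupp.lmapDomain_apply ℂ ℂ]
    subst h'
    simp only [map_sub, map_add, Finsupp.lmapDomain_apply, Finsupp.mapDomain_single, mkQ_single]
    have := mkQ_local (.xunder (q := q) a (b + 1) (m := m + 1) (k := a + 0 + b + 1) (by omega)
      (by omega))
    simp only [map_sub, map_add, mkQ_single] at this
    exact this
  | loop a b h h' =>
    rw [← Finsupp.lmapDomain_apply ℂ ℂ]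
    subst h'
    simp only [map_sub, Finsupp.lmapDomain_apply, Finsupp.mapDomain_single, mkQ_single]
    have := mkQ_local (.loop (q := q) a (b + 1) (m := m + 1) (k := a + 2 + b + 1) (by omega)
      (by omega))
    simp only [map_sub, mkQ_single] at this
    exact this

theorem insL_local {m n : ℕ} (y : Diagram m n →₀ ℂ) (hy : LocalRel q y) :
    (skeinRel q (m + 1) (n + 1)).mkQ (Finsupp.mapDomain Diagram.insL y) = 0 := by
  cases hy with
  | isotopy h =>
    rw [← Finsupp.lmapDomain_apply ℂ ℂ]
    simp only [map_sub, Finsupp.lmapDomain_apply, Finsupp.mapDomain_single, mkQ_single, insL_move h,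
      sub_self]
  | xover a b h h' =>
    rw [← Finsupp.lmapDomain_apply ℂ ℂ]
    subst h'
    simp only [map_sub, map_add, Finsupp.lmapDomain_apply, Finsupp.mapDomain_single, mkQ_single]
    have := mkQ_local (.xover (q := q) (a + 1) b (m := m + 1) (k := a + 0 + b + 1) (by omega)
      (by omega))
    simp only [map_sub, map_add, mkQ_single] at this
    exact this
  | xunder a b h h' =>
    rw [← Finsupp.lmapDomain_apply ℂ ℂ]
    subst h'
    simp only [map_sub, map_add, Finsupp.lmapDomain_apply, Finsupp.mapDomain_single, mkQ_single]
    have := mkQ_local (.xunder (q := q) (a + 1) b (m := m + 1) (k := a + 0 + b + 1) (by omega)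
      (by omega))
    simp only [map_sub, map_add, mkQ_single] at this
    exact this
  | loop a b h h' =>
    rw [← Finsupp.lmapDomain_apply ℂ ℂ]
    subst h'
    simp only [map_sub, Finsupp.lmapDomain_apply, Finsupp.mapDomain_single, mkQ_single]
    have := mkQ_local (.loop (q := q) (a + 1) b (m := m + 1) (k := a + 2 + b + 1) (by omega)
      (by omega))
    simp only [map_sub, mkQ_single] at this
    exact this

/-- `[D] ↦ [D ∗ Id₁]`. -/
noncomputable def insR {m n : ℕ} : Skein q m n →ₗ[ℂ] Skein q (m + 1) (n + 1) :=
  Submodule.liftQ _ ((skeinRel q (m + 1) (n + 1)).mkQ ∘ₗ Finsupp.lmapDomain ℂ ℂ Diagram.insR)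
    (functor_ker Diagram.insR insR_comp insR_local m n)

/-- `[D] ↦ [Id₁ ∗ D]`. -/
noncomputable def insL {m n : ℕ} : Skein q m n →ₗ[ℂ] Skein q (m + 1) (n + 1) :=
  Submodule.liftQ _ ((skeinRel q (m + 1) (n + 1)).mkQ ∘ₗ Finsupp.lmapDomain ℂ ℂ Diagram.insL)
    (functor_ker Diagram.insL insL_comp insL_local m n)

/-- `[D] ↦ [D ∗ Id_j]`: insertion of `j` last strands below all strands of `D`. -/
noncomputable def insRN : (j : ℕ) → {m n : ℕ} → Skein q m n →ₗ[ℂ] Skein q (m + j) (n + j)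
  | 0, _, _ => LinearMap.id
  | j + 1, _, _ => insR ∘ₗ insRN j

/-- `[D] ↦ [Id_j ∗ D]`: insertion of `j` first strands above all strands of `D`. -/
noncomputable def insLN : (j : ℕ) → {m n : ℕ} → Skein q m n →ₗ[ℂ] Skein q (m + j) (n + j)
  | 0, _, _ => LinearMap.id
  | j + 1, _, _ => insL ∘ₗ insLN j

/-- Transport along equalities of objects. -/
noncomputable def cast {m m' n n' : ℕ} (hm : m = m') (hn : n = n') : Skein q m n →ₗ[ℂ] Skein q m' n' :=
  match m', n', hm, hn with
  | _, _, rfl, rfl => LinearMap.id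

/-- The tensor product `×_S` of the skein category: for a `(k, l)`-diagram `D` and an
`(m, n)`-diagram `D'`, `[D] ×_S [D'] = [D ∗ D']`, where `D ∗ D'` is the diagram with `D` on top of
`D'`, the endpoints of `D` in the first places and those of `D'` in the last places. The diagram is
drawn here with `D` (accompanied by the `n` outgoing strands of `D'`, which run below it) outside of
`D'` (accompanied by the `k` incoming strands of `D`, which run above it). -/
noncomputable def tensor {k l m n : ℕ} :
    Skein q k l →ₗ[ℂ] Skein q m n →ₗ[ℂ] Skein q (k + m) (l + n) :=
  LinearMap.compl₁₂ (comp (q := q) (l := k + m) (m := k + n) (n := l + n)) (insRN n)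
    (cast (Nat.add_comm m k) (Nat.add_comm n k) ∘ₗ insLN k)

/-- The arc insertion functor `I = - ×_S 1` on morphisms. -/
noncomputable def arcInsertion {m n : ℕ} : Skein q m n →ₗ[ℂ] Skein q (m + 1) (n + 1) :=
  tensor.flip (one q 1)

/-- The generator `X` of `End_S(0)`: the class of a loop around the hole of the annulus. -/
noncomputable def loopX (q : ℂˣ) : Skein q 0 0 :=
  mk q (snoc (two (place (n := 2) 0 .cup 0 rfl rfl) (rot (n := 2) 1 rfl rfl))
    (place 0 .cap 0 rfl rfl))

/-- The class of the turn of `k + 1` strands; for `k = 0` this is the Dehn twist `ρ ∈ End_S(1)`. -/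
noncomputable def rho (q : ℂˣ) (k : ℕ) : Skein q (k + 1) (k + 1) := ly q (rot k rfl rfl)

/-- `[c₊]`: the arc that joins the outer endpoints 1 and 2 without crossing the ray between the
endpoints 2 and 1. -/
noncomputable def cPlus (q : ℂˣ) : Skein q 0 2 := ly q (place 0 .cup 0 rfl rfl)

/-- `[c₋]`: the arc that joins the outer endpoints 1 and 2 on the other side of the hole. -/
noncomputable def cMinus (q : ℂˣ) : Skein q 0 2 := comp (rho q 1) (cPlus q)

/-- `U = t^{1/4} [c₊] + v [c₋]`. -/
noncomputable def U (q v : ℂˣ) : Skein q 0 2 := (q : ℂ) • cPlus q + (v : ℂ) • cMinus q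

end Skein

open Skein

/-- The generator of `End_S(0) = ℂ[X]`, respectively of `End_S(1) = ℂ[ρ, ρ⁻¹]` (only the values
`e = 0, 1` are used). -/
noncomputable def generator (q : ℂˣ) : (e : ℕ) → Skein q e e
  | 0 => loopX q
  | k + 1 => rho q k

/-- The scalar by which the generator acts: the noncontractible loop weight
`t^{1/4} v + t^{-1/4} v⁻¹` for `e = 0`, the twist weight `v` for `e = 1`. -/
noncomputable def weight (q v : ℂˣ) : ℕ → ℂ
  | 0 => (q : ℂ) * v + (q : ℂ)⁻¹ * (v : ℂ)⁻¹
  | _ + 1 => v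

/-- The `n`-th representation space of the link pattern tower. With `e ∈ {0, 1}` the residue of `n`
modulo two, it is `Hom_S(e, n) ⊗_{End_S(e)} ℂ`, where the generator of `End_S(e)` acts on `ℂ` by its
weight; that is, `Hom_S(e, n)` modulo the subspace of the elements `Y ∘ X - u Y` for even `n`, and of
the elements `Y ∘ ρ - v Y` for odd `n` (the relations for the powers of `X`, `ρ` and for `ρ⁻¹`
follow). -/
def V (q v : ℂˣ) (n : ℕ) : Type :=
  Skein q (n % 2) n ⧸
    LinearMap.range (comp.flip (generator q (n % 2)) - weight q v (n % 2) • LinearMap.id :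
      Skein q (n % 2) n →ₗ[ℂ] Skein q (n % 2) n)

noncomputable instance (q v : ℂˣ) (n : ℕ) : AddCommGroup (V q v n) :=
  inferInstanceAs (AddCommGroup (Skein q (n % 2) n ⧸ _))

noncomputable instance (q v : ℂˣ) (n : ℕ) : Module ℂ (V q v n) :=
  inferInstanceAs (Module ℂ (Skein q (n % 2) n ⧸ _))

/-- The class of `Y ∈ Hom_S(e, n)` in the representation space, `e` the residue of `n` modulo two. -/
noncomputable def bar (q v : ℂˣ) {n e : ℕ} (h : n % 2 = e) : Skein q e n →ₗ[ℂ] V q v n :=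
  match e, h with
  | _, rfl => Submodule.mkQ (LinearMap.range
      (comp.flip (generator q (n % 2)) - weight q v (n % 2) • LinearMap.id))

/-- The left action of `End_S(n)` on the representation space, by composition. -/
noncomputable def act (q v : ℂˣ) {n : ℕ} (a : Skein q n n) : V q v n →ₗ[ℂ] V q v n :=
  Submodule.mapQ _ _ (comp a) (by
    rintro _ ⟨Y, rfl⟩
    refine ⟨comp a Y, ?_⟩
    simp [comp_assoc])

/-- The maps `φ n` are the connecting maps of the link pattern tower with twist weight `v`:
`φ (Y) = I(Y)` for even `n`, `φ (Z) = I(Z) ∘ U` for odd `n`, and they intertwine the actions of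
`End_S(n)`, which acts on the target through the arc insertion `End_S(n) → End_S(n + 1)`. -/
structure IsLinkPatternTower (q v : ℂˣ) (φ : ∀ n, V q v n →ₗ[ℂ] V q v (n + 1)) : Prop where
  even : ∀ (n : ℕ) (h : n % 2 = 0) (Y : Skein q 0 n),
    φ n (bar q v h Y) = bar q v (e := 1) (by omega) (arcInsertion Y)
  odd : ∀ (n : ℕ) (h : n % 2 = 1) (Z : Skein q 1 n),
    φ n (bar q v h Z) = bar q v (e := 0) (by omega) (comp (arcInsertion Z) (U q v))
  intertwines : ∀ (n : ℕ) (a : Skein q n n) (y : V q v n),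
    φ n (act q v a y) = act q v (arcInsertion a) (φ n y)

/-- The direct sum of the representation spaces of the link pattern tower with twist weight 1. -/
abbrev A (q : ℂˣ) : Type := DirectSum ℕ (V q 1)

/-- The inclusion of the `n`-th summand. -/
noncomputable abbrev incl (q : ℂˣ) (n : ℕ) : V q 1 n →ₗ[ℂ] A q := DirectSum.lof ℂ ℕ (V q 1) n

/-- `μ` is the product on the direct sum that is given on homogeneous elements by `Y ×_S Z`,
composed with `U` if both degrees are odd. -/
structure IsSkeinProduct (q : ℂˣ) (μ : A q →ₗ[ℂ] A q →ₗ[ℂ] A q) : Prop where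
  even_even : ∀ (m n : ℕ) (hm : m % 2 = 0) (hn : n % 2 = 0) (Y : Skein q 0 m) (Z : Skein q 0 n),
    μ (incl q m (bar q 1 hm Y)) (incl q n (bar q 1 hn Z))
      = incl q (m + n) (bar q 1 (e := 0) (by omega) (tensor Y Z))
  even_odd : ∀ (m n : ℕ) (hm : m % 2 = 0) (hn : n % 2 = 1) (Y : Skein q 0 m) (Z : Skein q 1 n),
    μ (incl q m (bar q 1 hm Y)) (incl q n (bar q 1 hn Z))
      = incl q (m + n) (bar q 1 (e := 1) (by omega) (tensor Y Z))
  odd_even : ∀ (m n : ℕ) (hm : m % 2 = 1) (hn : n % 2 = 0) (Y : Skein q 1 m) (Z : Skein q 0 n),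
    μ (incl q m (bar q 1 hm Y)) (incl q n (bar q 1 hn Z))
      = incl q (m + n) (bar q 1 (e := 1) (by omega) (tensor Y Z))
  odd_odd : ∀ (m n : ℕ) (hm : m % 2 = 1) (hn : n % 2 = 1) (Y : Skein q 1 m) (Z : Skein q 1 n),
    μ (incl q m (bar q 1 hm Y)) (incl q n (bar q 1 hn Z))
      = incl q (m + n) (bar q 1 (e := 0) (by omega) (comp (tensor Y Z) (U q 1)))

end AnnularSkein

open AnnularSkein

open AnnularSkein

namespace AnnularSkein

open Diagram Layer

namespace Skein

variable {q : ℂˣ}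

/-! Transport along equalities of objects. -/

/-! The heart of the matter is that `tensor` is a bifunctor, and that its failure to descend to the
quotients `V` is repaired by `U`. Write `q` for `t^{1/4}`.

Interchange. Since `tensor` draws the upper diagram outside the lower one, functoriality amounts to
sliding the two past each other radially (`Exchanges`). This property is linear and closed under
composition and inverses, so `Exchanges.all` only has to check generators. Pieces at disjoint places
exchange by planar isotopy. Turns of many strands are built from the twist `ρ` of one strand by
inserting strands and composing with crossings, and crossings are combinations of the identity and
`cup ∘ cap`. What remains is `ρ` against a cup, a cap and `ρ`: there a cup or cap slides across a
strand, or a crossing is carried once around the annulus. The interchange law `tensor_comp` follows;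
`tensor_assoc` holds by padding alone.

Descent to the quotients. By interchange, composing one factor on the inside with the generator `X`
or `ρ` places that generator, beside identity strands, in front of the element `joint` (an identity
or `U`). Skein computations give `X × 1 = qρ + q⁻¹ρ⁻¹` and `1 × X = q⁻¹ρ + qρ⁻¹`; both act by the
loop weight `q + q⁻¹` once `ρ` acts by 1. They also show that `(ρ × 1) ∘ U` and `(1 × ρ) ∘ U` differ
from `U` by multiples of `c ∘ X - (q + q⁻¹) c` for `c = c₋` and `c = c₊` (`insR_rho_U`,
`insL_rho_U`). Hence the product is well defined (`bar_joint_left`, `bar_joint_right`).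

Associativity. Interchange moves all joints to the inside, leaving a comparison for each triple of
parities. Only three odd factors are not formal: there `U × 1` and `1 × U` must agree modulo `ρ =
1`, which is `bar_insR_U`.

Connecting maps. Right multiplication by the class of `1₁` has the two prescribed values by
definition of the product, and intertwines the actions by interchange. Uniqueness of the maps and of
the product holds because every element of `V` is the class of a skein. -/

theorem cast_cast {m m' m'' n n' n'' : ℕ} (hm : m = m') (hn : n = n') (hm' : m' = m'')
    (hn' : n' = n'') (Y : Skein q m n) :
    Skein.cast hm' hn' (Skein.cast hm hn Y)
      = Skein.cast (hm.trans hm') (hn.trans hn') Y := by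
  subst hm hn hm' hn'; rfl

theorem comp_cast {l l' m m' n n' : ℕ} (hl : l = l') (hm hm' : m = m') (hn : n = n')
    (Y : Skein q m n) (Z : Skein q l m) :
    comp (Skein.cast hm hn Y) (Skein.cast hl hm' Z) = Skein.cast hl hn (comp Y Z) := by
  subst hl hm hn; rfl

theorem cast_one {m n : ℕ} (h h' : m = n) : Skein.cast h h' (one q m) = one q n := by
  subst h; rfl

theorem cast_ly_place {m m' n n' r s : ℕ} (hm : m = m') (hn : n = n') (a b : ℕ) (p : Piece r s)
    (h₁ : m = a + r + b) (h₂ : n = a + s + b) :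
    Skein.cast hm hn (ly q (place a p b h₁ h₂))
      = ly q (place a p b (hm ▸ h₁) (hn ▸ h₂)) := by
  subst hm hn; rfl

theorem ly_place_congr {m n r s : ℕ} {a a' b b' : ℕ} (p : Piece r s)
    (h₁ : m = a + r + b) (h₂ : n = a + s + b) (ha : a = a') (hb : b = b') :
    ly q (place a p b h₁ h₂ : Layer m n)
      = ly q (place a' p b' (ha ▸ hb ▸ h₁) (ha ▸ hb ▸ h₂)) := by
  subst ha hb; rfl

/-! Induction over skein classes. -/

theorem induction_linear {m n : ℕ} {P : Skein q m n → Prop} (zero : P 0)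
    (add : ∀ Y Z, P Y → P Z → P (Y + Z)) (smul : ∀ (c : ℂ) Y, P Y → P (c • Y))
    (mk : ∀ D, P (mk q D)) (Y : Skein q m n) : P Y := by
  obtain ⟨y, rfl⟩ := Submodule.mkQ_surjective _ Y
  induction y using Finsupp.induction_linear with
  | zero => simpa only [map_zero] using zero
  | add f g hf hg => simpa only [map_add] using add _ _ hf hg
  | single D c => rw [mkQ_single]; exact smul _ _ (mk D)

/-- A property of skein classes that is stable under linear combinations and composition holds
everywhere as soon as it holds for all layers. -/
theorem induction_layers {P : ∀ {m n : ℕ}, Skein q m n → Prop}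
    (zero : ∀ {m n : ℕ}, P (0 : Skein q m n))
    (add : ∀ {m n : ℕ} (Y Z : Skein q m n), P Y → P Z → P (Y + Z))
    (smul : ∀ {m n : ℕ} (c : ℂ) (Y : Skein q m n), P Y → P (c • Y))
    (one : ∀ n : ℕ, P (one q n))
    (comp : ∀ {l m n : ℕ} (Y : Skein q m n) (Z : Skein q l m), P Y → P Z → P (comp Y Z))
    (layer : ∀ {m n : ℕ} (e : Layer m n), P (ly q e)) {m n : ℕ} (Y : Skein q m n) : P Y := by
  refine induction_linear zero add smul (fun D => ?_) Y
  clear Y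
  induction D with
  | straight => exact one _
  | snoc D e ih => rw [mk_snoc]; exact comp _ _ (layer e) ih

/-! Strand insertion on skein classes. -/

theorem insR_mk {m n : ℕ} (D : Diagram m n) : insR (mk q D) = mk q D.insR := by
  rw [insR, mk, Submodule.liftQ_apply]
  simp [mk]

theorem insL_mk {m n : ℕ} (D : Diagram m n) : insL (mk q D) = mk q D.insL := by
  rw [insL, mk, Submodule.liftQ_apply]
  simp [mk]

theorem insR_comp' {l m n : ℕ} (Y : Skein q m n) (Z : Skein q l m) :
    insR (comp Y Z) = comp (insR Y) (insR Z) := by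
  induction Y using induction_linear with
  | zero => simp
  | add Y Y' h h' => simp [h, h']
  | smul c Y h => simp [h]
  | mk E =>
    induction Z using induction_linear with
    | zero => simp
    | add Y Y' h h' => simp [h, h']
    | smul c Y h => simp [h]
    | mk D => simp only [comp_mk, insR_mk, insR_comp]

theorem insL_comp' {l m n : ℕ} (Y : Skein q m n) (Z : Skein q l m) :
    insL (comp Y Z) = comp (insL Y) (insL Z) := by
  induction Y using induction_linear with
  | zero => simp
  | add Y Y' h h' => simp [h, h']
  | smul c Y h => simp [h]
  | mk E =>
    induction Z using induction_linear with
    | zero => simp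
    | add Y Y' h h' => simp [h, h']
    | smul c Y h => simp [h]
    | mk D => simp only [comp_mk, insL_mk, insL_comp]

theorem insR_one (n : ℕ) : insR (one q n) = one q (n + 1) := insR_mk _

theorem insL_one (n : ℕ) : insL (one q n) = one q (n + 1) := insL_mk _

theorem insR_place {m n r s : ℕ} (a b : ℕ) (p : Piece r s) (h₁ : m = a + r + b)
    (h₂ : n = a + s + b) :
    insR (ly q (place a p b h₁ h₂)) = ly q (place a p (b + 1) (by omega) (by omega)) :=
  insR_mk _

theorem insL_place {m n r s : ℕ} (a b : ℕ) (p : Piece r s) (h₁ : m = a + r + b)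
    (h₂ : n = a + s + b) :
    insL (ly q (place a p b h₁ h₂)) = ly q (place (a + 1) p b (by omega) (by omega)) :=
  insL_mk _

theorem insR_rot {m : ℕ} (k : ℕ) (h : m = k + 1) :
    insR (ly q (rot k h h)) = comp (ly q (rot (m := m + 1) (k + 1) (by omega) (by omega)))
      (ly q (place k .xover 0 (by omega) (by omega))) :=
  (insR_mk _).trans (mk_two _ _)

theorem insL_rot {m : ℕ} (k : ℕ) (h : m = k + 1) :
    insL (ly q (rot k h h)) = comp (ly q (place (m := m + 1) 0 .xunder k (by omega) (by omega)))
      (ly q (rot (k + 1) (by omega) (by omega))) :=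
  (insL_mk _).trans (mk_two _ _)

/-- On a single layer the two orders of insertion give the same diagram: for a turn, the crossing
added by one insertion lies inside the turn and the crossing added by the other outside it, so they
do not interact. -/
theorem insL_insR {m n : ℕ} (Y : Skein q m n) : insL (insR Y) = insR (insL Y) := by
  induction Y using induction_linear with
  | zero => simp
  | add Y Y' h h' => simp [h, h']
  | smul c Y h => simp [h]
  | mk D =>
    induction D with
    | straight => simp only [insL_mk, insR_mk]; rfl
    | snoc D e ih =>
      have he : insL (insR (ly q e)) = insR (insL (ly q e)) := by
        cases e with
        | place a p b hm hn => simp only [insL_place, insR_place]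
        | rot k hm hn =>
          simp only [ly, insL_mk, insR_mk]; rfl
        | rotInv k hm hn =>
          simp only [ly, insL_mk, insR_mk]; rfl
      simp only [mk_snoc, insR_comp', insL_comp', ih, he]

theorem insR_cast {m m' n n' : ℕ} (hm : m = m') (hn : n = n') (Y : Skein q m n) :
    insR (Skein.cast hm hn Y)
      = Skein.cast (congrArg (· + 1) hm) (congrArg (· + 1) hn) (insR Y) := by
  subst hm hn; rfl

theorem insL_cast {m m' n n' : ℕ} (hm : m = m') (hn : n = n') (Y : Skein q m n) :
    insL (Skein.cast hm hn Y)
      = Skein.cast (congrArg (· + 1) hm) (congrArg (· + 1) hn) (insL Y) := by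
  subst hm hn; rfl

/-! ### Padding with several strands on either side -/

theorem insRN_comp (j : ℕ) {l m n : ℕ} (Y : Skein q m n) (Z : Skein q l m) :
    insRN j (comp Y Z) = comp (insRN j Y) (insRN j Z) := by
  induction j with
  | zero => rfl
  | succ j ih => exact (congrArg insR ih).trans (insR_comp' _ _)

theorem insRN_one (j n : ℕ) : insRN j (one q n) = one q (n + j) := by
  induction j with
  | zero => rfl
  | succ j ih => exact (congrArg insR ih).trans (insR_one _)

theorem insRN_insL (j : ℕ) {m n : ℕ} (Y : Skein q m n) :
    insRN j (insL Y) = Skein.cast (by omega) (by omega) (insL (insRN j Y)) := by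
  induction j with
  | zero => rfl
  | succ j ih =>
    refine (congrArg insR ih).trans ?_
    rw [insR_cast, ← insL_insR]
    rfl

theorem insRN_insR (j : ℕ) {m n : ℕ} (Y : Skein q m n) :
    insRN j (insR Y) = Skein.cast (by omega) (by omega) (insRN (j + 1) Y) := by
  induction j with
  | zero => rfl
  | succ j ih =>
    refine (congrArg insR ih).trans ?_
    rw [insR_cast]
    rfl

theorem insRN_insRN (i j : ℕ) {m n : ℕ} (Y : Skein q m n) :
    insRN j (insRN i Y) = Skein.cast (by omega) (by omega) (insRN (i + j) Y) := by
  induction j with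
  | zero => rfl
  | succ j ih =>
    refine (congrArg insR ih).trans ?_
    rw [insR_cast]
    rfl

/-- `[D] ↦ [Id_k ∗ D]`, with the new strands counted first. -/
noncomputable def idTensor (k : ℕ) {m n : ℕ} : Skein q m n →ₗ[ℂ] Skein q (k + m) (k + n) :=
  Skein.cast (Nat.add_comm m k) (Nat.add_comm n k) ∘ₗ insLN k

theorem tensor_apply {k l m n : ℕ} (Y : Skein q k l) (Z : Skein q m n) :
    tensor Y Z = comp (insRN n Y) (idTensor k Z) := rfl

theorem idTensor_succ (k : ℕ) {m n : ℕ} (Z : Skein q m n) :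
    idTensor (k + 1) Z = Skein.cast (by omega) (by omega) (insL (idTensor k Z)) := by
  rw [idTensor, idTensor, LinearMap.comp_apply, LinearMap.comp_apply, insL_cast, cast_cast]
  rfl

theorem idTensor_zero {m n : ℕ} (Z : Skein q m n) :
    idTensor 0 Z = Skein.cast (by omega) (by omega) Z := rfl

theorem idTensor_cast (k : ℕ) {m m' n n' : ℕ} (hm : m = m') (hn : n = n') (Z : Skein q m n) :
    idTensor k (Skein.cast hm hn Z) = Skein.cast (by omega) (by omega) (idTensor k Z) := by
  subst hm hn; rfl

theorem idTensor_comp (k : ℕ) {l m n : ℕ} (Y : Skein q m n) (Z : Skein q l m) :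
    idTensor k (comp Y Z) = comp (idTensor k Y) (idTensor k Z) := by
  induction k with
  | zero => simp only [idTensor_zero, comp_cast]
  | succ k ih => simp only [idTensor_succ, ih, insL_comp', comp_cast]

theorem idTensor_one (k n : ℕ) : idTensor k (one q n) = one q (k + n) := by
  induction k with
  | zero => simp only [idTensor_zero, cast_one]
  | succ k ih => simp only [idTensor_succ, ih, insL_one, cast_one]

theorem idTensor_insL (k : ℕ) {m n : ℕ} (Z : Skein q m n) :
    idTensor k (insL Z) = Skein.cast (by omega) (by omega) (idTensor (k + 1) Z) := by
  induction k with
  | zero => simp only [idTensor_succ, idTensor_zero, insL_cast, cast_cast]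
  | succ k ih => rw [idTensor_succ, ih, idTensor_succ (k + 1)]; simp only [insL_cast, cast_cast]

theorem idTensor_insR (k : ℕ) {m n : ℕ} (Z : Skein q m n) :
    idTensor k (insR Z) = insR (idTensor k Z) := by
  induction k with
  | zero => simp only [idTensor_zero, insR_cast]
  | succ k ih => simp only [idTensor_succ, ih, insR_cast, insL_insR]

/-- Strands added before and strands added after do not interfere. This identifies the middle factor
of the two bracketings of a triple tensor product. -/
theorem idTensor_insRN (k j : ℕ) {m n : ℕ} (Z : Skein q m n) :
    insRN j (idTensor k Z) = Skein.cast (by omega) (by omega) (idTensor k (insRN j Z)) := by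
  induction j with
  | zero => rfl
  | succ j ih =>
    refine (congrArg insR ih).trans ?_
    rw [insR_cast, ← idTensor_insR]
    rfl

theorem idTensor_idTensor (k j : ℕ) {m n : ℕ} (Z : Skein q m n) :
    idTensor (k + j) Z = Skein.cast (by omega) (by omega) (idTensor k (idTensor j Z)) := by
  induction j with
  | zero => simp only [idTensor_zero, idTensor_cast, cast_cast]; rfl
  | succ j ih =>
    refine (idTensor_succ (k + j) Z).trans ?_
    rw [ih]
    simp only [idTensor_succ, idTensor_cast, idTensor_insL, insL_cast, cast_cast]

theorem idTensor_place (k : ℕ) {m n r s : ℕ} (a b : ℕ) (p : Piece r s) (h₁ : m = a + r + b)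
    (h₂ : n = a + s + b) :
    idTensor k (ly q (place a p b h₁ h₂))
      = ly q (place (k + a) p b (by omega) (by omega)) := by
  induction k with
  | zero =>
    rw [idTensor_zero, cast_ly_place]
    exact ly_place_congr p _ _ (Nat.zero_add a).symm rfl
  | succ k ih =>
    rw [idTensor_succ, ih, insL_place, cast_ly_place]
    exact ly_place_congr p _ _ (by omega) rfl

theorem insRN_place (j : ℕ) {m n r s : ℕ} (a b : ℕ) (p : Piece r s) (h₁ : m = a + r + b)
    (h₂ : n = a + s + b) :
    insRN j (ly q (place a p b h₁ h₂)) = ly q (place a p (b + j) (by omega) (by omega)) := by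
  induction j with
  | zero => rfl
  | succ j ih => exact (congrArg insR ih).trans (insR_place _ _ _ _ _)

/-! ### Sliding cups and caps across a strand; splitting a strand off a turn -/

theorem comp_assoc_eq_one {k l m : ℕ} {Y : Skein q l m} {Z : Skein q m l}
    (h : comp Y Z = one q m) (W : Skein q k m) : comp Y (comp Z W) = W := by
  rw [← comp_assoc, h, one_comp]

/-- This is `cup_slide` for the opposite type of crossing, solved for the other cup: the two types
of crossing are mutually inverse. -/
theorem cup_slide_inv {m n : ℕ} (a b : ℕ) (p : Piece 2 2) (h₁ : n = a + 1 + 2 + b)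
    (h₂ : n = a + 2 + (b + 1)) (h₃ : m = a + 0 + (b + 1)) (h₄ : m = a + 1 + 0 + b) :
    comp (ly q (place (a + 1) p b h₁ h₁)) (comp (ly q (place a p (b + 1) h₂ h₂))
      (ly q (place (a + 1) .cup b h₄ h₁))) = ly q (place a .cup (b + 1) h₃ h₂) := by
  cases p with
  | xover =>
    rw [← cup_slide a b .xunder h₁ h₂ h₃ h₄, comp_assoc_eq_one (over_under _ _ _),
      comp_assoc_eq_one (over_under _ _ _)]
  | xunder =>
    rw [← cup_slide a b .xover h₁ h₂ h₃ h₄, comp_assoc_eq_one (under_over _ _ _),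
      comp_assoc_eq_one (under_over _ _ _)]

theorem cap_slide_inv {m n : ℕ} (a b : ℕ) (p : Piece 2 2) (h₁ : m = a + 1 + 2 + b)
    (h₂ : m = a + 2 + (b + 1)) (h₃ : n = a + 0 + (b + 1)) (h₄ : n = a + 1 + 0 + b) :
    comp (ly q (place a .cap (b + 1) h₂ h₃)) (comp (ly q (place (a + 1) p b h₁ h₁))
      (ly q (place a p (b + 1) h₂ h₂))) = ly q (place (a + 1) .cap b h₁ h₄) := by
  cases p with
  | xover =>
    rw [← cap_slide a b .xunder h₁ h₂ h₃ h₄, comp_assoc, comp_assoc,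
      comp_assoc_eq_one (under_over _ _ _), under_over, comp_one]
  | xunder =>
    rw [← cap_slide a b .xover h₁ h₂ h₃ h₄, comp_assoc, comp_assoc,
      comp_assoc_eq_one (over_under _ _ _), over_under, comp_one]

/-- A turn of `k + 2` strands, with the last strand split off. -/
theorem rot_succ_eq_insR {m : ℕ} (k : ℕ) (h : m = k + 1) :
    ly q (rot (m := m + 1) (n := m + 1) (k + 1) (by omega) (by omega))
      = comp (insR (ly q (rot k h h))) (ly q (place k .xunder 0 (by omega) (by omega))) := by
  rw [insR_rot, comp_assoc, over_under, comp_one]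

/-- A turn of `k + 2` strands, with the first strand split off. -/
theorem rot_succ_eq_insL {m : ℕ} (k : ℕ) (h : m = k + 1) :
    ly q (rot (m := m + 1) (n := m + 1) (k + 1) (by omega) (by omega))
      = comp (ly q (place 0 .xover k (by omega) (by omega))) (insL (ly q (rot k h h))) := by
  rw [insL_rot, comp_assoc_eq_one (over_under _ _ _)]

/-! ### Radial exchange of an upper and a lower diagram -/

/-- The diagram `Y`, placed on top of the outgoing strands of `Z`, can be exchanged radially with
`Z`, placed below the strands of `Y`. -/
def Exchanges {k l m n : ℕ} (Y : Skein q k l) (Z : Skein q m n) : Prop :=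
  comp (insRN n Y) (idTensor k Z) = comp (idTensor l Z) (insRN m Y)

namespace Exchanges

variable {k l m n : ℕ}

theorem zero_left (Z : Skein q m n) : Exchanges (0 : Skein q k l) Z := by
  simp [Exchanges]

theorem zero_right (Y : Skein q k l) : Exchanges Y (0 : Skein q m n) := by
  simp [Exchanges]

theorem add_left {Y Y' : Skein q k l} {Z : Skein q m n} (h : Exchanges Y Z)
    (h' : Exchanges Y' Z) : Exchanges (Y + Y') Z := by
  unfold Exchanges at *
  simp only [map_add, LinearMap.add_apply, h, h']

theorem add_right {Y : Skein q k l} {Z Z' : Skein q m n} (h : Exchanges Y Z)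
    (h' : Exchanges Y Z') : Exchanges Y (Z + Z') := by
  unfold Exchanges at *
  simp only [map_add, LinearMap.add_apply, h, h']

theorem smul_left {Y : Skein q k l} {Z : Skein q m n} (c : ℂ) (h : Exchanges Y Z) :
    Exchanges (c • Y) Z := by
  unfold Exchanges at *
  simp only [map_smul, LinearMap.smul_apply, h]

theorem smul_right {Y : Skein q k l} {Z : Skein q m n} (c : ℂ) (h : Exchanges Y Z) :
    Exchanges Y (c • Z) := by
  unfold Exchanges at *
  simp only [map_smul, LinearMap.smul_apply, h]

theorem one_left (Z : Skein q m n) : Exchanges (one q k) Z := by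
  simp only [Exchanges, insRN_one, one_comp, comp_one]

theorem one_right (Y : Skein q k l) : Exchanges Y (one q m) := by
  simp only [Exchanges, idTensor_one, one_comp, comp_one]

theorem comp_left {j : ℕ} {Y : Skein q k l} {Y' : Skein q j k} {Z : Skein q m n}
    (h : Exchanges Y Z) (h' : Exchanges Y' Z) : Exchanges (comp Y Y') Z := by
  unfold Exchanges at *
  rw [insRN_comp, insRN_comp, comp_assoc, h', ← comp_assoc, h, comp_assoc]

theorem comp_right {j : ℕ} {Y : Skein q k l} {Z : Skein q m n} {Z' : Skein q j m}
    (h : Exchanges Y Z) (h' : Exchanges Y Z') : Exchanges Y (comp Z Z') := by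
  unfold Exchanges at *
  rw [idTensor_comp, idTensor_comp, ← comp_assoc, h, comp_assoc, h', comp_assoc]

/-- Padding is functorial, so the padded inverses are inverse to the padded factors and the exchange
identity can be multiplied by them on both sides. This disposes of clockwise turns. -/
theorem inv_left {Y : Skein q k l} {Y' : Skein q l k} {Z : Skein q m n} (h : Exchanges Y Z)
    (h₁ : comp Y Y' = one q l) (h₂ : comp Y' Y = one q k) : Exchanges Y' Z := by
  unfold Exchanges at *
  have e₁ : comp (insRN m Y) (insRN m Y') = one q (l + m) := by
    rw [← insRN_comp, h₁, insRN_one]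
  have e₂ : comp (insRN n Y') (insRN n Y) = one q (k + n) := by
    rw [← insRN_comp, h₂, insRN_one]
  rw [← comp_one (comp (insRN n Y') (idTensor l Z)), ← e₁, comp_assoc,
    ← comp_assoc (idTensor l Z), ← h, comp_assoc, comp_assoc_eq_one e₂]

theorem inv_right {Y : Skein q k l} {Z : Skein q m n} {Z' : Skein q n m} (h : Exchanges Y Z)
    (h₁ : comp Z Z' = one q n) (h₂ : comp Z' Z = one q m) : Exchanges Y Z' := by
  unfold Exchanges at *
  have e₁ : comp (idTensor k Z) (idTensor k Z') = one q (k + n) := by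
    rw [← idTensor_comp, h₁, idTensor_one]
  have e₂ : comp (idTensor l Z') (idTensor l Z) = one q (l + m) := by
    rw [← idTensor_comp, h₂, idTensor_one]
  rw [← comp_one (comp (idTensor l Z') (insRN n Y)), ← e₁, comp_assoc,
    ← comp_assoc (insRN n Y), h, comp_assoc, comp_assoc_eq_one e₂]

/-- The extra strand is last in the whole picture, so it can be added to both sides of the exchange
identity at once; it then counts as part of the lower factor. -/
theorem insR_right {Y : Skein q k l} {Z : Skein q m n} (h : Exchanges Y Z) :
    Exchanges Y (insR Z) := by
  have := congrArg insR h
  rw [insR_comp', insR_comp'] at this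
  unfold Exchanges
  rw [idTensor_insR, idTensor_insR]
  exact this

theorem insL_left {Y : Skein q k l} {Z : Skein q m n} (h : Exchanges Y Z) :
    Exchanges (insL Y) Z := by
  have := congrArg insL h
  rw [insL_comp', insL_comp'] at this
  unfold Exchanges
  rw [insRN_insL, insRN_insL, idTensor_succ, idTensor_succ, comp_cast, comp_cast, this]

/-- A strand between the two diagrams may be counted as the last strand of the upper factor or as
the first strand of the lower one. Up to transport the two exchange identities are the same
equation. `insL_right` is the converse. -/
theorem insR_left {Y : Skein q k l} {Z : Skein q m n} (h : Exchanges Y (insL Z)) :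
    Exchanges (insR Y) Z := by
  unfold Exchanges at h
  rw [idTensor_insL, idTensor_insL] at h
  have e := congrArg (Skein.cast (q := q) (show k + (m + 1) = k + 1 + m by omega)
    (show l + (n + 1) = l + 1 + n by omega)) h
  rw [← comp_cast _ (show k + (n + 1) = k + 1 + n by omega) (by omega),
    ← comp_cast _ (show l + (m + 1) = l + 1 + m by omega) (by omega)] at e
  simp only [cast_cast] at e
  unfold Exchanges
  rw [insRN_insR, insRN_insR]
  exact e

theorem insL_right {Y : Skein q k l} {Z : Skein q m n} (h : Exchanges (insR Y) Z) :
    Exchanges Y (insL Z) := by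
  unfold Exchanges at h
  rw [insRN_insR, insRN_insR] at h
  have e := congrArg (Skein.cast (q := q) (show k + 1 + m = k + (m + 1) by omega)
    (show l + 1 + n = l + (n + 1) by omega)) h
  rw [← comp_cast _ (show k + 1 + n = k + (n + 1) by omega) (by omega),
    ← comp_cast _ (show l + 1 + m = l + (m + 1) by omega) (by omega)] at e
  simp only [cast_cast] at e
  unfold Exchanges
  rw [idTensor_insL, idTensor_insL]
  exact e

/-- The two pieces are separated by `b + a'` radial strands, so this is the elementary isotopy
`ly_exchange`. -/
theorem place_place {r s r' s' : ℕ} (a b : ℕ) (p : Piece r s) (h₁ : k = a + r + b)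
    (h₂ : l = a + s + b) (a' b' : ℕ) (p' : Piece r' s') (h₁' : m = a' + r' + b')
    (h₂' : n = a' + s' + b') :
    Exchanges (ly q (place a p b h₁ h₂)) (ly q (place a' p' b' h₁' h₂')) := by
  unfold Exchanges
  rw [insRN_place, insRN_place, idTensor_place, idTensor_place,
    ly_place_congr p _ _ rfl (show b + n = b + a' + s' + b' by omega),
    ly_place_congr p _ _ rfl (show b + m = b + a' + r' + b' by omega),
    ly_place_congr p' _ _ (show k + a' = a + r + (b + a') by omega) rfl,
    ly_place_congr p' _ _ (show l + a' = a + s + (b + a') by omega) rfl]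
  exact (ly_exchange a (b + a') b' p p' _ _ _ _ _ _ _ _).symm

theorem idTensor_two_rho : idTensor 2 (rho q 0)
    = comp (ly q (place 1 .xunder 0 rfl rfl))
      (comp (ly q (place 0 .xunder 1 rfl rfl)) (ly q (rot (m := 3) (n := 3) 2 rfl rfl))) := by
  change insL (insL (ly q (rot 0 rfl rfl))) = _
  rw [insL_rot, insL_comp', insL_rot, insL_place]

theorem insRN_two_rho : insRN 2 (rho q 0)
    = comp (ly q (rot (m := 3) (n := 3) 2 rfl rfl)) (comp (ly q (place 1 .xover 0 rfl rfl))
      (ly q (place 0 .xover 1 rfl rfl))) := by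
  change insR (insR (ly q (rot 0 rfl rfl))) = _
  rw [insR_rot, insR_comp', insR_rot, insR_place, comp_assoc]

theorem rot_cup : comp (ly q (rot (m := 3) (n := 3) 2 rfl rfl))
    (ly q (place (m := 1) 0 .cup 1 rfl rfl))
      = comp (ly q (place (m := 1) 1 .cup 0 rfl rfl)) (rho q 0) :=
  ly_place_rot 0 0 .cup rfl rfl rfl rfl rfl rfl

theorem rot_cap : comp (rho q 0) (ly q (place (m := 3) 0 .cap 1 rfl rfl))
    = comp (ly q (place (m := 3) (n := 1) 1 .cap 0 rfl rfl))
      (ly q (rot (m := 3) (n := 3) 2 rfl rfl)) :=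
  ly_place_rot 0 0 .cap rfl rfl rfl rfl rfl rfl

/-- The turn of three strands carries the cup from the first two places to the last two (`rot_cup`).
The two crossings left over from padding `ρ` then slide it back across the lower strand. The next
three lemmas combine a turn and a slide in the same way. -/
theorem cup_rho : Exchanges (ly q (place (m := 0) (n := 2) 0 .cup 0 rfl rfl)) (rho q 0) := by
  have e : insRN 1 (ly q (place (m := 0) (n := 2) 0 .cup 0 rfl rfl))
      = ly q (place (m := 1) (n := 3) 0 .cup 1 rfl rfl) := insRN_place _ _ _ _ _ _
  have f := cup_slide_inv (q := q) (m := 1) (n := 3) 0 0 .xunder rfl rfl rfl rfl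
  change comp (insRN 1 _) (rho q 0) = comp (idTensor 2 (rho q 0)) (insRN 1 _)
  rw [e, idTensor_two_rho, comp_assoc, comp_assoc, rot_cup, ← f]
  simp only [comp_assoc]

theorem cap_rho : Exchanges (ly q (place (m := 2) (n := 0) 0 .cap 0 rfl rfl)) (rho q 0) := by
  have e : insRN 1 (ly q (place (m := 2) (n := 0) 0 .cap 0 rfl rfl))
      = ly q (place (m := 3) (n := 1) 0 .cap 1 rfl rfl) := insRN_place _ _ _ _ _ _
  have f := cap_slide_inv (q := q) (m := 3) (n := 1) 0 0 .xunder rfl rfl rfl rfl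
  change comp (insRN 1 _) (idTensor 2 (rho q 0)) = comp (rho q 0) (insRN 1 _)
  rw [e, idTensor_two_rho, rot_cap, ← f]
  simp only [comp_assoc]

theorem rho_cup : Exchanges (rho q 0) (ly q (place (m := 0) (n := 2) 0 .cup 0 rfl rfl)) := by
  have e : idTensor 1 (ly q (place (m := 0) (n := 2) 0 .cup 0 rfl rfl))
      = ly q (place (m := 1) (n := 3) 1 .cup 0 rfl rfl) := idTensor_place _ _ _ _ _ _
  have f := cup_slide_inv (q := q) (m := 1) (n := 3) 0 0 .xover rfl rfl rfl rfl
  let c : Skein q 0 2 := ly q (place 0 .cup 0 rfl rfl)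
  change comp (insRN 2 (rho q 0)) (idTensor 1 c) = comp (m := 1) (idTensor 1 c) (rho q 0)
  rw [e, insRN_two_rho, ← rot_cup, ← f]
  simp only [comp_assoc]

theorem rho_cap : Exchanges (rho q 0) (ly q (place (m := 2) (n := 0) 0 .cap 0 rfl rfl)) := by
  have e : idTensor 1 (ly q (place (m := 2) (n := 0) 0 .cap 0 rfl rfl))
      = ly q (place (m := 3) (n := 1) 1 .cap 0 rfl rfl) := idTensor_place _ _ _ _ _ _
  have f := cap_slide_inv (q := q) (m := 3) (n := 1) 0 0 .xover rfl rfl rfl rfl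
  let c : Skein q 2 0 := ly q (place 0 .cap 0 rfl rfl)
  change comp (m := 1) (rho q 0) (idTensor 1 c) = comp (m := 3) (idTensor 1 c) (insRN 2 (rho q 0))
  rw [e, insRN_two_rho, ← comp_assoc (ly q (place 1 .cap 0 _ _)), ← rot_cap, comp_assoc]
  exact congrArg _ f.symm

/-- Both sides equal the double turn of two strands. On one side the two crossings are adjacent and
cancel; on the other, one of them is first carried once around the annulus by `wrap_cross`. -/
theorem rho_rho : Exchanges (rho q 0) (rho q 0) := by
  have e : insRN 1 (rho q 0) = comp (ly q (rot 1 rfl rfl)) (ly q (place 0 .xover 0 rfl rfl)) :=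
    insR_rot 0 rfl
  have f : idTensor 1 (rho q 0) = comp (ly q (place 0 .xunder 0 rfl rfl)) (ly q (rot 1 rfl rfl)) :=
    insL_rot 0 rfl
  unfold Exchanges
  rw [e, f, comp_assoc, comp_assoc, comp_assoc_eq_one (over_under _ _ _),
    wrap_cross 0 1 .xover rfl rfl rfl, comp_assoc_eq_one (under_over _ _ _)]

/-- Exchange with all layers follows from exchange with the pieces and with the twist. -/
theorem of_generators_right {Y : Skein q k l}
    (hp : ∀ {m n r s : ℕ} (a b : ℕ) (p : Piece r s) (h₁ : m = a + r + b) (h₂ : n = a + s + b),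
      Exchanges Y (ly q (place a p b h₁ h₂)))
    (hr : Exchanges Y (rho q 0)) (Z : Skein q m n) : Exchanges Y Z := by
  have hrot : ∀ (k m : ℕ) (h : m = k + 1), Exchanges Y (ly q (rot k h h)) := by
    intro k
    induction k with
    | zero => rintro m rfl; exact hr
    | succ k ih =>
      rintro m rfl
      -- Splitting off the last strand is the right choice for a lower factor, since `insR_right`
      -- needs no further hypothesis; for an upper factor the first strand is split off and
      -- `insL_left` is used.
      rw [rot_succ_eq_insR k rfl]
      exact comp_right (insR_right (ih _ rfl)) (hp _ _ _ _ _)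
  refine induction_layers (P := Exchanges Y) (zero_right Y) (fun _ _ => add_right)
    (fun c _ => smul_right c) (fun n => one_right Y) (fun _ _ => comp_right) (fun e => ?_) Z
  cases e with
  | place a p b h₁ h₂ => exact hp a b p h₁ h₂
  | rot k h h' => obtain rfl := h.trans h'.symm; exact hrot k _ h
  | rotInv k h h' =>
    obtain rfl := h.trans h'.symm
    exact inv_right (hrot k _ h) (rotInv_cancel k h) (rot_cancel k h)

theorem of_generators_left {Z : Skein q m n}
    (hp : ∀ {k l r s : ℕ} (a b : ℕ) (p : Piece r s) (h₁ : k = a + r + b) (h₂ : l = a + s + b),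
      Exchanges (ly q (place a p b h₁ h₂)) Z)
    (hr : Exchanges (rho q 0) Z) (Y : Skein q k l) : Exchanges Y Z := by
  have hrot : ∀ (k m : ℕ) (h : m = k + 1), Exchanges (ly q (rot k h h)) Z := by
    intro k
    induction k with
    | zero => rintro m rfl; exact hr
    | succ k ih =>
      rintro m rfl
      rw [rot_succ_eq_insL k rfl]
      exact comp_left (hp _ _ _ _ _) (insL_left (ih _ rfl))
  refine induction_layers (P := fun Y => Exchanges Y Z) (zero_left Z) (fun _ _ => add_left)
    (fun c _ => smul_left c) (fun n => one_left Z) (fun _ _ => comp_left) (fun e => ?_) Y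
  cases e with
  | place a p b h₁ h₂ => exact hp a b p h₁ h₂
  | rot k h h' => obtain rfl := h.trans h'.symm; exact hrot k _ h
  | rotInv k h h' =>
    obtain rfl := h.trans h'.symm
    exact inv_left (hrot k _ h) (rotInv_cancel k h) (rot_cancel k h)

/-- The radial strands beside the piece are removed one at a time until the bare cup or cap is left.
Strands before the piece are the leftmost ones and come off freely; strands after it lie between the
piece and `ρ` and must be transferred to the lower factor. -/
theorem place_rho {r s : ℕ} (a b : ℕ) (p : Piece r s) (h₁ : k = a + r + b)
    (h₂ : l = a + s + b) : Exchanges (ly q (place a p b h₁ h₂)) (rho q 0) := by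
  induction a generalizing k l with
  | succ a ih =>
    obtain ⟨k, rfl⟩ : ∃ k', k = k' + 1 := ⟨a + r + b, by omega⟩
    obtain ⟨l, rfl⟩ : ∃ l', l = l' + 1 := ⟨a + s + b, by omega⟩
    rw [← insL_place a b p (by omega) (by omega)]
    exact insL_left (ih _ _)
  | zero =>
    induction b generalizing k l with
    | succ b ih =>
      obtain ⟨k, rfl⟩ : ∃ k', k = k' + 1 := ⟨0 + r + b, by omega⟩
      obtain ⟨l, rfl⟩ : ∃ l', l = l' + 1 := ⟨0 + s + b, by omega⟩
      rw [← insR_place 0 b p (by omega) (by omega)]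
      refine insR_left ?_
      -- Rewriting the turn of two strands makes `insL ρ` equal to `insR ρ` with a crossing on
      -- either side. The strand is thereby moved from the left of `ρ` to its right, where the
      -- induction hypothesis with one strand fewer applies.
      rw [rho, insL_rot, rot_succ_eq_insR 0 rfl]
      exact comp_right (place_place _ _ _ _ _ _ _ _ _ _)
        (comp_right (insR_right (ih _ _)) (place_place _ _ _ _ _ _ _ _ _ _))
    | zero =>
      subst h₁ h₂
      cases p with
      | cup => exact cup_rho
      | cap => exact cap_rho
      | xover =>
        -- The skein relation reduces a crossing to the identity and the composite of a cap and a
        -- cup, all of which are already settled.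
        rw [ly_over 0 0 _ rfl]
        exact add_left (smul_left _ (one_left _)) (smul_left _ (comp_left cup_rho cap_rho))
      | xunder =>
        rw [ly_under 0 0 _ rfl]
        exact add_left (smul_left _ (one_left _)) (smul_left _ (comp_left cup_rho cap_rho))

theorem rho_place {r s : ℕ} (a b : ℕ) (p : Piece r s) (h₁ : m = a + r + b)
    (h₂ : n = a + s + b) : Exchanges (rho q 0) (ly q (place a p b h₁ h₂)) := by
  induction b generalizing m n with
  | succ b ih =>
    obtain ⟨m, rfl⟩ : ∃ k', m = k' + 1 := ⟨a + r + b, by omega⟩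
    obtain ⟨n, rfl⟩ : ∃ l', n = l' + 1 := ⟨a + s + b, by omega⟩
    rw [← insR_place a b p (by omega) (by omega)]
    exact insR_right (ih _ _)
  | zero =>
    induction a generalizing m n with
    | succ a ih =>
      obtain ⟨m, rfl⟩ : ∃ k', m = k' + 1 := ⟨a + r + 0, by omega⟩
      obtain ⟨n, rfl⟩ : ∃ l', n = l' + 1 := ⟨a + s + 0, by omega⟩
      rw [← insL_place a 0 p (by omega) (by omega)]
      refine insL_right ?_
      -- Here the strand moves the other way: `insR ρ` becomes `insL ρ` with a crossing on either
      -- side.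
      rw [rho, insR_rot, rot_succ_eq_insL 0 rfl]
      exact comp_left (comp_left (place_place _ _ _ _ _ _ _ _ _ _) (insL_left (ih _ _)))
        (place_place _ _ _ _ _ _ _ _ _ _)
    | zero =>
      subst h₁ h₂
      cases p with
      | cup => exact rho_cup
      | cap => exact rho_cap
      | xover =>
        rw [ly_over 0 0 _ rfl]
        exact add_right (smul_right _ (one_right _)) (smul_right _ (comp_right rho_cup rho_cap))
      | xunder =>
        rw [ly_under 0 0 _ rfl]
        exact add_right (smul_right _ (one_right _)) (smul_right _ (comp_right rho_cup rho_cap))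

theorem all (Y : Skein q k l) (Z : Skein q m n) : Exchanges Y Z :=
  of_generators_left
    (fun a b p h₁ h₂ => of_generators_right
      (fun _ _ _ _ _ => place_place _ _ _ _ _ _ _ _ _ _) (place_rho a b p h₁ h₂) Z)
    (of_generators_right (fun a b p h₁ h₂ => rho_place a b p h₁ h₂) rho_rho Z) Y

end Exchanges

/-! ### The tensor product as an associative bifunctor -/

/-- The interchange law. -/
theorem tensor_comp {j k l i m n : ℕ} (Y' : Skein q k l) (Y : Skein q j k) (Z' : Skein q m n)
    (Z : Skein q i m) :
    tensor (comp Y' Y) (comp Z' Z) = comp (tensor Y' Z') (tensor Y Z) := by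
  have h : comp (insRN n Y) (idTensor j Z') = comp (idTensor k Z') (insRN m Y) :=
    Exchanges.all Y Z'
  simp only [tensor_apply, insRN_comp, idTensor_comp]
  rw [comp_assoc, ← comp_assoc (insRN n Y), h]
  simp only [comp_assoc]

/-- Either bracketing unfolds to one composite of the three padded factors, with `Y` outermost and
`W` innermost. No exchange of factors is involved. -/
theorem tensor_assoc {j k l m n i : ℕ} (Y : Skein q i j) (Z : Skein q k l) (W : Skein q m n) :
    tensor (tensor Y Z) W
      = Skein.cast (by omega) (by omega) (tensor Y (tensor Z W)) := by
  simp only [tensor_apply, insRN_comp, idTensor_comp, insRN_insRN, idTensor_insRN,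
    idTensor_idTensor, comp_assoc, comp_cast]

theorem tensor_one_right {k l : ℕ} (n : ℕ) (Y : Skein q k l) : tensor Y (one q n) = insRN n Y := by
  rw [tensor_apply, idTensor_one, comp_one]

theorem tensor_one_left {m n : ℕ} (k : ℕ) (Z : Skein q m n) :
    tensor (one q k) Z = idTensor k Z := by
  rw [tensor_apply, insRN_one, one_comp]

/-! ### Skein computations with `ρ`, `X` and `U` on at most three strands -/

/-- The twist `ρ`. -/
noncomputable def turnOne (q : ℂˣ) : Skein q 1 1 := rho q 0

/-- The turn of two strands. -/
noncomputable def turnTwo (q : ℂˣ) : Skein q 2 2 := rho q 1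

/-- The turn of three strands. -/
noncomputable def turnThree (q : ℂˣ) : Skein q 3 3 := rho q 2

theorem cMinus_eq : cMinus q = comp (turnTwo q) (cPlus q) := rfl

theorem insR_rho : insR (turnOne q) = comp (turnTwo q) (ly q (place 0 .xover 0 rfl rfl)) :=
  insR_rot 0 rfl

theorem insL_rho : insL (turnOne q) = comp (ly q (place 0 .xunder 0 rfl rfl)) (turnTwo q) :=
  insL_rot 0 rfl

theorem insR_rho_one : insR (turnTwo q) = comp (turnThree q) (ly q (place 1 .xover 0 rfl rfl)) :=
  insR_rot 1 rfl

theorem insL_rho_one : insL (turnTwo q) = comp (ly q (place 0 .xunder 1 rfl rfl)) (turnThree q) :=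
  insL_rot 1 rfl

theorem rho_rho_cPlus : comp (turnTwo q) (comp (turnTwo q) (cPlus q)) = cPlus q :=
  wrap_cup 0 1 rfl rfl rfl rfl rfl

theorem rho_cMinus : comp (turnTwo q) (cMinus q) = cPlus q := rho_rho_cPlus

/-- The cap on two strands. -/
noncomputable def capTwo (q : ℂˣ) : Skein q 2 0 := ly q (place 0 .cap 0 rfl rfl)

theorem capTwo_cPlus : comp (capTwo q) (cPlus q)
    = (-((q : ℂ) ^ 2 + ((q : ℂ)⁻¹) ^ 2)) • one q 0 :=
  ly_loop 0 0 rfl rfl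

theorem capTwo_cMinus : comp (capTwo q) (cMinus q) = loopX q := by
  rw [loopX, mk_snoc, mk_two]; rfl

theorem xover_two : ly q (place (m := 2) (n := 2) 0 .xover 0 rfl rfl)
    = (q : ℂ) • one q 2 + (q : ℂ)⁻¹ • comp (cPlus q) (capTwo q) :=
  ly_over 0 0 rfl rfl

theorem xunder_two : ly q (place (m := 2) (n := 2) 0 .xunder 0 rfl rfl)
    = (q : ℂ)⁻¹ • one q 2 + (q : ℂ) • comp (cPlus q) (capTwo q) :=
  ly_under 0 0 rfl rfl

/-- Resolving the one crossing of `ρ × 1` produces the contractible loop and the loop `X`. The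
coefficient `q` of `c₊` in `U` makes the loop factor cancel so that the error is a multiple of the
defining relation for `X`. Thus `U` is fixed by `ρ × 1` in the quotient; `insL_rho_U` gives the same
for `1 × ρ`, with error along `c₊` instead of `c₋`. -/
theorem insR_rho_U : comp (m := 2) (insR (turnOne q)) (U q 1)
    = U q 1 + (q : ℂ)⁻¹ • (comp (cMinus q) (loopX q)
        - ((q : ℂ) + (q : ℂ)⁻¹) • cMinus q) := by
  have hq : (q : ℂ) ≠ 0 := q.ne_zero
  have key : comp (comp (turnTwo q) (ly q (place (m := 2) (n := 2) 0 .xover 0 rfl rfl))) (U q 1)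
      = U q 1 + (q : ℂ)⁻¹ • (comp (cMinus q) (loopX q)
        - ((q : ℂ) + (q : ℂ)⁻¹) • cMinus q) := by
    rw [xover_two, comp_assoc, U]
    simp only [map_add, map_smul, LinearMap.add_apply, LinearMap.smul_apply, one_comp, comp_assoc,
      capTwo_cPlus, capTwo_cMinus, comp_one, rho_cMinus, Units.val_one]
    rw [← comp_assoc (turnTwo q), ← cMinus_eq]
    match_scalars <;> field_simp
    ring
  rw [insR_rho]
  exact key

theorem insL_rho_U : comp (m := 2) (insL (turnOne q)) (U q 1)
    = U q 1 + (q : ℂ) ^ 2 • (comp (cPlus q) (loopX q)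
        - ((q : ℂ) + (q : ℂ)⁻¹) • cPlus q) := by
  have hq : (q : ℂ) ≠ 0 := q.ne_zero
  have key : comp (comp (ly q (place (m := 2) (n := 2) 0 .xunder 0 rfl rfl)) (turnTwo q)) (U q 1)
      = U q 1 + (q : ℂ) ^ 2 • (comp (cPlus q) (loopX q)
        - ((q : ℂ) + (q : ℂ)⁻¹) • cPlus q) := by
    rw [xunder_two, comp_assoc, U]
    simp only [map_add, map_smul, LinearMap.add_apply, LinearMap.smul_apply, one_comp, comp_assoc,
      ← cMinus_eq, capTwo_cPlus, capTwo_cMinus, rho_cMinus, comp_one, Units.val_one]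
    match_scalars <;> field_simp
    ring
  rw [insL_rho]
  exact key

/-- The cup in the first two of three places. -/
noncomputable def cupFirst (q : ℂˣ) : Skein q 1 3 := ly q (place 0 .cup 1 rfl rfl)

/-- The cup in the last two of three places. -/
noncomputable def cupLast (q : ℂˣ) : Skein q 1 3 := ly q (place 1 .cup 0 rfl rfl)

/-- The cap in the first two of three places. -/
noncomputable def capFirst (q : ℂˣ) : Skein q 3 1 := ly q (place 0 .cap 1 rfl rfl)

/-- The cap in the last two of three places. -/
noncomputable def capLast (q : ℂˣ) : Skein q 3 1 := ly q (place 1 .cap 0 rfl rfl)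

theorem capLast_cupFirst : comp (capLast q) (cupFirst q) = one q 1 :=
  (mk_two _ _).symm.trans (mk_move (.zagzig 0 0 rfl rfl rfl rfl))

theorem capFirst_cupLast : comp (capFirst q) (cupLast q) = one q 1 :=
  (mk_two _ _).symm.trans (mk_move (.zigzag 0 0 rfl rfl rfl rfl))

theorem rho_cupFirst : comp (turnThree q) (cupFirst q) = comp (cupLast q) (turnOne q) :=
  Exchanges.rot_cup

theorem capLast_rho : comp (capLast q) (turnThree q) = comp (turnOne q) (capFirst q) :=
  Exchanges.rot_cap.symm

theorem rho_rho_cupLast : comp (turnThree q) (comp (turnThree q) (cupLast q)) = cupFirst q :=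
  wrap_cup 1 2 rfl rfl rfl rfl rfl

theorem xover_three : ly q (place (m := 3) (n := 3) 1 .xover 0 rfl rfl)
    = (q : ℂ) • one q 3 + (q : ℂ)⁻¹ • comp (cupLast q) (capLast q) :=
  ly_over 1 0 rfl rfl

theorem xunder_three : ly q (place (m := 3) (n := 3) 0 .xunder 1 rfl rfl)
    = (q : ℂ)⁻¹ • one q 3 + (q : ℂ) • comp (cupFirst q) (capFirst q) :=
  ly_under 0 1 rfl rfl

/-- The inverse of the twist `ρ`. -/
noncomputable def rhoInv (q : ℂˣ) : Skein q 1 1 := ly q (rotInv 0 rfl rfl)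

theorem rhoInv_rho : comp (rhoInv q) (turnOne q) = one q 1 := rot_cancel 0 rfl

/-- This arc winds once clockwise. Composing it with `ρ` moves the turn through the cap; the
resulting double turn carries the cup to the first place, where the zigzag straightens. -/
theorem capFirst_rho_cupLast : comp (capFirst q) (comp (turnThree q) (cupLast q)) = rhoInv q := by
  have h : comp (turnOne q) (comp (capFirst q) (comp (turnThree q) (cupLast q))) = one q 1 := by
    rw [← comp_assoc, ← capLast_rho, comp_assoc, rho_rho_cupLast, capLast_cupFirst]
  rw [← comp_one (rhoInv q), ← h, comp_assoc_eq_one rhoInv_rho]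

theorem insR_cPlus : insR (cPlus q) = cupFirst q := insR_place _ _ _ _ _

theorem insL_cPlus : insL (cPlus q) = cupLast q := insL_place _ _ _ _ _

/-- The inserted strand crosses `c₋` once. One smoothing leaves the cup turned by `rho_cupFirst`;
the other is straightened by `capLast_cupFirst`. -/
theorem insR_cMinus : insR (cMinus q) = (q : ℂ) • comp (cupLast q) (turnOne q)
    + (q : ℂ)⁻¹ • comp (turnThree q) (cupLast q) := by
  have key : comp (comp (turnThree q) (ly q (place (m := 3) (n := 3) 1 .xover 0 rfl rfl)))
      (cupFirst q) = (q : ℂ) • comp (cupLast q) (turnOne q)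
        + (q : ℂ)⁻¹ • comp (turnThree q) (cupLast q) := by
    rw [xover_three, comp_assoc]
    simp only [map_add, map_smul, LinearMap.add_apply, LinearMap.smul_apply, one_comp, comp_assoc,
      capLast_cupFirst, comp_one, rho_cupFirst]
  rw [cMinus_eq, insR_comp', insR_rho_one, insR_cPlus]
  exact key

theorem insL_cMinus : insL (cMinus q) = (q : ℂ)⁻¹ • comp (turnThree q) (cupLast q)
    + (q : ℂ) • comp (cupFirst q) (rhoInv q) := by
  have key : comp (comp (ly q (place (m := 3) (n := 3) 0 .xunder 1 rfl rfl)) (turnThree q))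
      (cupLast q) = (q : ℂ)⁻¹ • comp (turnThree q) (cupLast q)
        + (q : ℂ) • comp (cupFirst q) (rhoInv q) := by
    rw [xunder_three, comp_assoc]
    simp only [map_add, map_smul, LinearMap.add_apply, LinearMap.smul_apply, one_comp, comp_assoc,
      capFirst_rho_cupLast]
  rw [cMinus_eq, insL_comp', insL_rho_one, insL_cPlus]
  exact key

theorem insR_capTwo : insR (capTwo q) = capFirst q := insR_place _ _ _ _ _

theorem insL_capTwo : insL (capTwo q) = capLast q := insL_place _ _ _ _ _

/-- A loop around the hole meets the radial strand in one crossing, and its two smoothings wind the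
strand once in either direction. Passing the loop below instead of above the strand exchanges the
coefficients (`insL_loopX`); the two results agree when `ρ` and its inverse both act by 1. -/
theorem insR_loopX : insR (loopX q) = (q : ℂ) • turnOne q + (q : ℂ)⁻¹ • rhoInv q := by
  have key : comp (capFirst q) ((q : ℂ) • comp (cupLast q) (turnOne q)
      + (q : ℂ)⁻¹ • comp (turnThree q) (cupLast q))
        = (q : ℂ) • turnOne q + (q : ℂ)⁻¹ • rhoInv q := by
    simp only [map_add, map_smul, capFirst_rho_cupLast]
    rw [← comp_assoc, capFirst_cupLast, one_comp]
  rw [← capTwo_cMinus, insR_comp', insR_cMinus, insR_capTwo]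
  exact key

theorem insL_loopX : insL (loopX q) = (q : ℂ)⁻¹ • turnOne q + (q : ℂ) • rhoInv q := by
  have key : comp (capLast q) ((q : ℂ)⁻¹ • comp (turnThree q) (cupLast q)
      + (q : ℂ) • comp (cupFirst q) (rhoInv q))
        = (q : ℂ)⁻¹ • turnOne q + (q : ℂ) • rhoInv q := by
    simp only [map_add, map_smul]
    rw [← comp_assoc, ← comp_assoc (capLast q) (cupFirst q), capLast_rho, capLast_cupFirst,
      one_comp, comp_assoc, capFirst_cupLast, comp_one]
  rw [← capTwo_cMinus, insL_comp', insL_cMinus, insL_capTwo]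
  exact key

end Skein

open Skein

/-! ### The representation spaces as quotients -/

variable {q v : ℂˣ}

theorem bar_surjective {n e : ℕ} (h : n % 2 = e) : Function.Surjective (bar q v h) := by
  subst h
  exact Submodule.mkQ_surjective _

theorem bar_comp_generator {n e : ℕ} (h : n % 2 = e) (Y : Skein q e n) :
    bar q v h (comp Y (generator q e)) = weight q v e • bar q v h Y := by
  subst h
  rw [← map_smul, ← sub_eq_zero, ← map_sub]
  exact (Submodule.Quotient.mk_eq_zero _).2 ⟨Y, rfl⟩

theorem bar_comp_loopX {n : ℕ} (h : n % 2 = 0) (Y : Skein q 0 n) :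
    bar q 1 h (comp Y (loopX q)) = ((q : ℂ) + (q : ℂ)⁻¹) • bar q 1 h Y := by
  refine (bar_comp_generator h Y).trans ?_
  simp [weight]

theorem bar_comp_rho {n : ℕ} (h : n % 2 = 1) (Y : Skein q 1 n) :
    bar q 1 h (comp Y (turnOne q)) = bar q 1 h Y := by
  refine (bar_comp_generator h Y).trans ?_
  simp [weight]

theorem bar_comp_rhoInv {n : ℕ} (h : n % 2 = 1) (Y : Skein q 1 n) :
    bar q 1 h (comp Y (rhoInv q)) = bar q 1 h Y := by
  rw [← bar_comp_rho h (comp Y (rhoInv q)), comp_assoc, rhoInv_rho, comp_one]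

/-- The universal property of the representation space. -/
noncomputable def barLift {M : Type*} [AddCommGroup M] [Module ℂ M] {n e : ℕ} (h : n % 2 = e)
    (f : Skein q e n →ₗ[ℂ] M)
    (hf : ∀ Y, f (comp Y (generator q e)) = weight q v e • f Y) : V q v n →ₗ[ℂ] M :=
  Submodule.liftQ (LinearMap.range
      (comp.flip (generator q (n % 2)) - weight q v (n % 2) • LinearMap.id))
    (f ∘ₗ Skein.cast h rfl) (by
      subst h
      rintro _ ⟨Y, rfl⟩
      rw [LinearMap.mem_ker]
      change f (comp Y (generator q (n % 2)) - weight q v (n % 2) • Y) = 0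
      rw [map_sub, map_smul, hf, sub_self])

theorem barLift_bar {M : Type*} [AddCommGroup M] [Module ℂ M] {n e : ℕ} (h : n % 2 = e)
    (f : Skein q e n →ₗ[ℂ] M)
    (hf : ∀ Y, f (comp Y (generator q e)) = weight q v e • f Y) (Y : Skein q e n) :
    barLift h f hf (bar q v h Y) = f Y := by
  subst h; rfl

theorem act_bar {n e : ℕ} (h : n % 2 = e) (a : Skein q n n) (Y : Skein q e n) :
    act q v a (bar q v h Y) = bar q v h (comp a Y) := by
  subst h; rfl

/-! ### Compatibility of the joints with the defining relations -/

/-- The element with which the tensor product of classes of parities `e` and `f` is composed in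
order to obtain a class of parity `g`. -/
noncomputable def joint (q : ℂˣ) : (e f g : ℕ) → Skein q g (e + f)
  | 0, 0, 0 => one q 0
  | 0, 1, 1 => one q 1
  | 1, 0, 1 => one q 1
  | 1, 1, 0 => U q 1
  -- This value is irrelevant: `joint` is only evaluated at residues modulo two with `g` the residue
  -- of `e + f`.
  | _, _, _ => 0

/-- This is the descent condition in the left factor. If both parities are even, or only the left
one is odd, it is the defining relation itself. The case of parities 0 and 1 is `insR_loopX` with `ρ
= 1`; the case of two odd parities is `insR_rho_U`. -/
theorem bar_joint_left {N e f g : ℕ} (he : e < 2) (hf : f < 2) (h : (e + f) % 2 = g)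
    (hN : N % 2 = g) (T : Skein q (e + f) N) :
    bar q 1 hN (comp T (comp (tensor (generator q e) (one q f)) (joint q e f g)))
      = weight q 1 e • bar q 1 hN (comp T (joint q e f g)) := by
  rw [tensor_one_right]
  obtain rfl | rfl : e = 0 ∨ e = 1 := by omega
  · obtain rfl | rfl : f = 0 ∨ f = 1 := by omega
    · subst h
      change bar q 1 hN (comp T (comp (loopX q) (one q 0))) = _ • bar q 1 hN (comp T (one q 0))
      rw [comp_one, comp_one]
      exact bar_comp_generator hN T
    · subst h
      change bar q 1 hN (comp T (comp (insR (loopX q)) (one q 1)))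
        = _ • bar q 1 hN (comp T (one q 1))
      rw [comp_one, comp_one, insR_loopX, map_add, map_smul, map_smul, map_add, map_smul, map_smul]
      erw [bar_comp_rho hN T, bar_comp_rhoInv hN T]
      simp [weight, add_smul]
  · obtain rfl | rfl : f = 0 ∨ f = 1 := by omega
    · subst h
      change bar q 1 hN (comp T (comp (turnOne q) (one q 1))) = _ • bar q 1 hN (comp T (one q 1))
      rw [comp_one, comp_one]
      exact bar_comp_generator hN T
    · subst h
      change bar q 1 hN (comp T (comp (insR (turnOne q)) (U q 1)))
        = _ • bar q 1 hN (comp T (U q 1))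
      rw [insR_rho_U]
      simp only [map_add, map_sub, map_smul]
      rw [← comp_assoc]
      erw [bar_comp_loopX hN]
      simp [weight]

theorem bar_joint_right {N e f g : ℕ} (he : e < 2) (hf : f < 2) (h : (e + f) % 2 = g)
    (hN : N % 2 = g) (T : Skein q (e + f) N) :
    bar q 1 hN (comp T (comp (tensor (one q e) (generator q f)) (joint q e f g)))
      = weight q 1 f • bar q 1 hN (comp T (joint q e f g)) := by
  rw [tensor_one_left]
  obtain rfl | rfl : e = 0 ∨ e = 1 := by omega
  · obtain rfl | rfl : f = 0 ∨ f = 1 := by omega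
    · subst h
      change bar q 1 hN (comp T (comp (loopX q) (one q 0))) = _ • bar q 1 hN (comp T (one q 0))
      rw [comp_one, comp_one]
      exact bar_comp_generator hN T
    · subst h
      change bar q 1 hN (comp T (comp (turnOne q) (one q 1))) = _ • bar q 1 hN (comp T (one q 1))
      rw [comp_one, comp_one]
      exact bar_comp_generator hN T
  · obtain rfl | rfl : f = 0 ∨ f = 1 := by omega
    · subst h
      change bar q 1 hN (comp T (comp (insL (loopX q)) (one q 1)))
        = _ • bar q 1 hN (comp T (one q 1))
      rw [comp_one, comp_one, insL_loopX, map_add, map_smul, map_smul, map_add, map_smul, map_smul]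
      erw [bar_comp_rho hN T, bar_comp_rhoInv hN T]
      simp [weight, add_smul, add_comm]
    · subst h
      change bar q 1 hN (comp T (comp (insL (turnOne q)) (U q 1)))
        = _ • bar q 1 hN (comp T (U q 1))
      rw [insL_rho_U]
      simp only [map_add, map_sub, map_smul]
      rw [← comp_assoc]
      erw [bar_comp_loopX hN]
      simp [weight]

/-- The elements `U × 1` and `1 × U` agree modulo the twist. -/
theorem bar_insR_U {N : ℕ} (hN : N % 2 = 1) (T : Skein q 3 N) :
    bar q 1 hN (comp T (insR (U q 1))) = bar q 1 hN (comp T (insL (U q 1))) := by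
  simp only [U, map_add, map_smul, insR_cPlus, insR_cMinus, insL_cPlus, insL_cMinus]
  -- Once `ρ` on the left-hand side and its inverse on the right-hand side are absorbed, both sides
  -- are `q` times each of the two cups plus `q⁻¹` times the turned cup.
  rw [← comp_assoc, ← comp_assoc T (cupFirst q), bar_comp_rho, bar_comp_rhoInv]
  simp only [Units.val_one]
  module

/-- This is all of associativity that remains after the interchange law. As soon as one of the three
parities is even, both composites of joints reduce to the same identity or the same `U`. -/
theorem bar_joint_assoc {N d e f ab bc g : ℕ} (hd : d < 2) (he : e < 2) (hf : f < 2)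
    (hab : (d + e) % 2 = ab) (hbc : (e + f) % 2 = bc) (hg : (d + e + f) % 2 = g) (hN : N % 2 = g)
    (T : Skein q (d + (e + f)) N) :
    bar q 1 hN (comp (Skein.cast (Nat.add_assoc d e f).symm rfl T)
        (comp (tensor (joint q d e ab) (one q f)) (joint q ab f g)))
      = bar q 1 hN (comp T (comp (tensor (one q d) (joint q e f bc)) (joint q d bc g))) := by
  rw [tensor_one_left, tensor_one_right]
  obtain rfl | rfl : d = 0 ∨ d = 1 := by omega
  all_goals obtain rfl | rfl : e = 0 ∨ e = 1 := by omega
  all_goals obtain rfl | rfl : f = 0 ∨ f = 1 := by omega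
  all_goals subst hab hbc hg
  · change bar q 1 hN (comp T (comp (one q 0) (one q 0)))
      = bar q 1 hN (comp T (comp (one q 0) (one q 0)))
    rfl
  · change bar q 1 hN (comp T (comp (insR (one q 0)) (one q 1)))
      = bar q 1 hN (comp T (comp (one q 1) (one q 1)))
    rw [insR_one]
  · change bar q 1 hN (comp T (comp (one q 1) (one q 1)))
      = bar q 1 hN (comp T (comp (one q 1) (one q 1)))
    rfl
  · change bar q 1 hN (comp T (comp (insR (one q 1)) (U q 1)))
      = bar q 1 hN (comp T (comp (U q 1) (one q 0)))
    rw [insR_one, one_comp, comp_one]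
  · change bar q 1 hN (comp T (comp (one q 1) (one q 1)))
      = bar q 1 hN (comp T (comp (insL (one q 0)) (one q 1)))
    rw [insL_one]
  · change bar q 1 hN (comp T (comp (insR (one q 1)) (U q 1)))
      = bar q 1 hN (comp T (comp (insL (one q 1)) (U q 1)))
    rw [insL_one, insR_one]
  · change bar q 1 hN (comp T (comp (U q 1) (one q 0)))
      = bar q 1 hN (comp T (comp (insL (one q 1)) (U q 1)))
    rw [insL_one, one_comp, comp_one]
  -- Three odd factors: the only case in which the quotient by the twist is needed.
  · change bar q 1 hN (comp T (comp (insR (U q 1)) (one q 1)))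
      = bar q 1 hN (comp T (comp (insL (U q 1)) (one q 1)))
    rw [comp_one, comp_one]
    exact bar_insR_U hN T

/-! ### The product of homogeneous elements -/

/-- The product of two representation spaces, before passing to the quotients. -/
noncomputable def preMul (q : ℂˣ) (m n : ℕ) :
    Skein q (m % 2) m →ₗ[ℂ] Skein q (n % 2) n →ₗ[ℂ] V q 1 (m + n) :=
  tensor.compr₂ (bar q 1 rfl ∘ₗ comp.flip (joint q (m % 2) (n % 2) ((m + n) % 2)))

theorem preMul_apply {m n : ℕ} (Y : Skein q (m % 2) m) (Z : Skein q (n % 2) n) :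
    preMul q m n Y Z
      = bar q 1 rfl (comp (tensor Y Z) (joint q (m % 2) (n % 2) ((m + n) % 2))) := rfl

/-- The interchange law rewrites `(Y ∘ g) × Z` as `(Y × Z) ∘ (g × 1)`, which brings the generator
next to the joint. -/
theorem preMul_generator_left {m n : ℕ} (Y : Skein q (m % 2) m) (Z : Skein q (n % 2) n) :
    preMul q m n (comp Y (generator q (m % 2))) Z = weight q 1 (m % 2) • preMul q m n Y Z := by
  rw [preMul_apply, preMul_apply, ← bar_joint_left (by omega) (by omega) (by omega), ← comp_assoc,
    ← tensor_comp, comp_one]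

theorem preMul_generator_right {m n : ℕ} (Y : Skein q (m % 2) m) (Z : Skein q (n % 2) n) :
    preMul q m n Y (comp Z (generator q (n % 2))) = weight q 1 (n % 2) • preMul q m n Y Z := by
  rw [preMul_apply, preMul_apply, ← bar_joint_right (by omega) (by omega) (by omega), ← comp_assoc,
    ← tensor_comp, comp_one]

/-- The product of two representation spaces. -/
noncomputable def mul (q : ℂˣ) (m n : ℕ) : V q 1 m →ₗ[ℂ] V q 1 n →ₗ[ℂ] V q 1 (m + n) :=
  (barLift rfl (barLift rfl (preMul q m n) fun Y =>
      LinearMap.ext fun Z => preMul_generator_left Y Z).flip fun Z => by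
    ext x
    obtain ⟨Y, rfl⟩ := bar_surjective rfl x
    simp only [LinearMap.flip_apply, LinearMap.smul_apply, barLift_bar, preMul_generator_right]).flip

/-- The parities are free variables tied by equations, so that literal residues 0 and 1 can be
substituted and `joint` evaluates. -/
theorem mul_bar {m n e f g : ℕ} (hm : m % 2 = e) (hn : n % 2 = f) (hg : (m + n) % 2 = g)
    (Y : Skein q e m) (Z : Skein q f n) :
    mul q m n (bar q 1 hm Y) (bar q 1 hn Z)
      = bar q 1 hg (comp (tensor Y Z) (joint q e f g)) := by
  subst hm hn hg
  rw [mul, LinearMap.flip_apply, barLift_bar, LinearMap.flip_apply, barLift_bar, preMul_apply]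

theorem mul_bar_even_even {m n : ℕ} (hm : m % 2 = 0) (hn : n % 2 = 0) (h : (m + n) % 2 = 0)
    (Y : Skein q 0 m) (Z : Skein q 0 n) :
    mul q m n (bar q 1 hm Y) (bar q 1 hn Z) = bar q 1 h (tensor Y Z) :=
  (mul_bar hm hn h Y Z).trans (congrArg _ (comp_one _))

theorem mul_bar_even_odd {m n : ℕ} (hm : m % 2 = 0) (hn : n % 2 = 1) (h : (m + n) % 2 = 1)
    (Y : Skein q 0 m) (Z : Skein q 1 n) :
    mul q m n (bar q 1 hm Y) (bar q 1 hn Z) = bar q 1 h (tensor Y Z) :=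
  (mul_bar hm hn h Y Z).trans (congrArg _ (comp_one _))

theorem mul_bar_odd_even {m n : ℕ} (hm : m % 2 = 1) (hn : n % 2 = 0) (h : (m + n) % 2 = 1)
    (Y : Skein q 1 m) (Z : Skein q 0 n) :
    mul q m n (bar q 1 hm Y) (bar q 1 hn Z) = bar q 1 h (tensor Y Z) :=
  (mul_bar hm hn h Y Z).trans (congrArg _ (comp_one _))

theorem mul_bar_odd_odd {m n : ℕ} (hm : m % 2 = 1) (hn : n % 2 = 1) (h : (m + n) % 2 = 0)
    (Y : Skein q 1 m) (Z : Skein q 1 n) :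
    mul q m n (bar q 1 hm Y) (bar q 1 hn Z) = bar q 1 h (comp (tensor Y Z) (U q 1)) :=
  mul_bar hm hn h Y Z

theorem incl_bar_cast {m n e : ℕ} (h : m = n) (hm : m % 2 = e) (hn : n % 2 = e)
    (Y : Skein q e m) :
    incl q n (bar q 1 hn (Skein.cast rfl h Y)) = incl q m (bar q 1 hm Y) := by
  subst h; rfl

theorem incl_bar_comp_cast {m n k k' e : ℕ} (hk : k = k') (h : m = n) (hm : m % 2 = e)
    (hn : n % 2 = e) (Y : Skein q k m) (Z : Skein q e k') :
    incl q n (bar q 1 hn (comp (Skein.cast hk h Y) Z))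
      = incl q m (bar q 1 hm (comp (Skein.cast hk rfl Y) Z)) := by
  subst h; rfl

/-- The degrees `l + m + n` and `l + (m + n)` index different types, hence the comparison inside the
direct sum. Interchange with identities moves the inner joints inwards past the triple tensor
products, which agree by `tensor_assoc`; `bar_joint_assoc` compares what is left. -/
theorem incl_mul_assoc {l m n : ℕ} (x : V q 1 l) (y : V q 1 m) (z : V q 1 n) :
    incl q (l + m + n) (mul q (l + m) n (mul q l m x y) z)
      = incl q (l + (m + n)) (mul q l (m + n) x (mul q m n y z)) := by
  obtain ⟨X, rfl⟩ := bar_surjective rfl x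
  obtain ⟨Y, rfl⟩ := bar_surjective rfl y
  obtain ⟨Z, rfl⟩ := bar_surjective rfl z
  -- Both products are represented over the same inner number of endpoints, the residue of `l + m +
  -- n`.
  have hg : (l + (m + n)) % 2 = (l + m + n) % 2 := by omega
  rw [mul_bar (m := l) rfl rfl rfl, mul_bar rfl rfl rfl, mul_bar (m := m) rfl rfl rfl,
    mul_bar rfl rfl hg]
  have e₁ : tensor (comp (tensor X Y) (joint q (l % 2) (m % 2) ((l + m) % 2))) Z
      = comp (tensor (tensor X Y) Z)
        (tensor (joint q (l % 2) (m % 2) ((l + m) % 2)) (one q (n % 2))) := by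
    rw [← tensor_comp, comp_one]
  have e₂ : tensor X (comp (tensor Y Z) (joint q (m % 2) (n % 2) ((m + n) % 2)))
      = comp (tensor X (tensor Y Z))
        (tensor (one q (l % 2)) (joint q (m % 2) (n % 2) ((m + n) % 2))) := by
    rw [← tensor_comp, comp_one]
  rw [e₁, e₂, comp_assoc, comp_assoc, tensor_assoc, incl_bar_comp_cast _ (Nat.add_assoc l m n).symm
      hg, bar_joint_assoc (bc := (m + n) % 2) (Nat.mod_lt l two_pos) (Nat.mod_lt m two_pos) (Nat.mod_lt n two_pos)
      (by omega) (by omega) (by omega) hg]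

/-! ### The graded algebra -/

/-- The product on the direct sum of the representation spaces. -/
noncomputable def skeinProduct (q : ℂˣ) : A q →ₗ[ℂ] A q →ₗ[ℂ] A q :=
  DirectSum.toModule ℂ ℕ _ fun m =>
    (DirectSum.toModule ℂ ℕ _ fun n => ((mul q m n).compr₂ (incl q (m + n))).flip).flip

theorem skeinProduct_incl {m n : ℕ} (x : V q 1 m) (y : V q 1 n) :
    skeinProduct q (incl q m x) (incl q n y) = incl q (m + n) (mul q m n x y) := by
  rw [skeinProduct, DirectSum.toModule_lof, LinearMap.flip_apply, DirectSum.toModule_lof]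
  rfl

theorem isSkeinProduct_skeinProduct : IsSkeinProduct q (skeinProduct q) where
  even_even m n hm hn Y Z := by rw [skeinProduct_incl, mul_bar_even_even]
  even_odd m n hm hn Y Z := by rw [skeinProduct_incl, mul_bar_even_odd]
  odd_even m n hm hn Y Z := by rw [skeinProduct_incl, mul_bar_odd_even]
  odd_odd m n hm hn Y Z := by rw [skeinProduct_incl, mul_bar_odd_odd]

/-- A bilinear map on the direct sum is determined by homogeneous pairs. Each such pair consists of
classes of skeins, and the four parity cases prescribe all values. -/
theorem IsSkeinProduct.eq_skeinProduct {μ : A q →ₗ[ℂ] A q →ₗ[ℂ] A q} (h : IsSkeinProduct q μ) :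
    μ = skeinProduct q := by
  refine DirectSum.linearMap_ext ℂ fun m => LinearMap.ext fun x =>
    DirectSum.linearMap_ext ℂ fun n => LinearMap.ext fun y => ?_
  change μ (incl q m x) (incl q n y) = skeinProduct q (incl q m x) (incl q n y)
  have s := isSkeinProduct_skeinProduct (q := q)
  rcases Nat.mod_two_eq_zero_or_one m with hm | hm <;>
    rcases Nat.mod_two_eq_zero_or_one n with hn | hn <;>
    obtain ⟨Y, rfl⟩ := bar_surjective hm x <;> obtain ⟨Z, rfl⟩ := bar_surjective hn y
  · rw [h.even_even, s.even_even]
  · rw [h.even_odd, s.even_odd]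
  · rw [h.odd_even, s.odd_even]
  · rw [h.odd_odd, s.odd_odd]

theorem skeinProduct_assoc (x y z : A q) :
    skeinProduct q (skeinProduct q x y) z = skeinProduct q x (skeinProduct q y z) := by
  induction x using DirectSum.induction_on with
  | zero => simp
  | add x x' h h' => simp only [map_add, LinearMap.add_apply, h, h']
  | of l x =>
    induction y using DirectSum.induction_on with
    | zero => simp
    | add x x' h h' => simp only [map_add, LinearMap.add_apply, h, h']
    | of m y =>
      induction z using DirectSum.induction_on with
      | zero => simp
      | add x x' h h' => simp only [map_add, h, h']
      | of n z =>
        change skeinProduct q (skeinProduct q (incl q l x) (incl q m y)) (incl q n z)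
          = skeinProduct q (incl q l x) (skeinProduct q (incl q m y) (incl q n z))
        simp only [skeinProduct_incl, incl_mul_assoc]

theorem skeinProduct_one_left (x : A q) :
    skeinProduct q (incl q 0 (bar q 1 (e := 0) rfl (Skein.one q 0))) x = x := by
  induction x using DirectSum.induction_on with
  | zero => simp
  | add x x' h h' => simp only [map_add, h, h']
  | of n x =>
    change skeinProduct q _ (incl q n x) = incl q n x
    -- The product lies in degree `0 + n`, which has to be transported to `n`. For the right unit
    -- the degree `n + 0` is `n` by definition and no transport occurs.
    have hn : (0 + n) % 2 = n % 2 := by omega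
    rw [skeinProduct_incl]
    rcases Nat.mod_two_eq_zero_or_one n with h | h <;> obtain ⟨Y, rfl⟩ := bar_surjective h x
    · rw [mul_bar_even_even _ _ (hn.trans h), tensor_one_left, idTensor_zero]
      exact incl_bar_cast _ _ _ _
    · rw [mul_bar_even_odd _ _ (hn.trans h), tensor_one_left, idTensor_zero]
      exact incl_bar_cast _ _ _ _

theorem skeinProduct_one_right (x : A q) :
    skeinProduct q x (incl q 0 (bar q 1 (e := 0) rfl (Skein.one q 0))) = x := by
  induction x using DirectSum.induction_on with
  | zero => simp
  | add x x' h h' => simp only [map_add, LinearMap.add_apply, h, h']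
  | of n x =>
    change skeinProduct q (incl q n x) _ = incl q n x
    rw [skeinProduct_incl]
    rcases Nat.mod_two_eq_zero_or_one n with h | h <;> obtain ⟨Y, rfl⟩ := bar_surjective h x
    · rw [mul_bar_even_even _ _ h, tensor_one_right]
      rfl
    · rw [mul_bar_odd_even _ _ h, tensor_one_right]
      rfl

/-! ### Connecting maps as right multiplication -/

/-- The connecting maps of the link pattern tower. -/
noncomputable def connecting (q : ℂˣ) (n : ℕ) : V q 1 n →ₗ[ℂ] V q 1 (n + 1) :=
  (mul q n 1).flip (bar q 1 (e := 1) rfl (Skein.one q 1))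

theorem connecting_apply {n : ℕ} (y : V q 1 n) :
    connecting q n y = mul q n 1 y (bar q 1 (e := 1) rfl (Skein.one q 1)) :=
  LinearMap.flip_apply _ _ _

theorem arcInsertion_apply {m n : ℕ} (Y : Skein q m n) : arcInsertion Y = tensor Y (one q 1) :=
  LinearMap.flip_apply _ _ _

theorem arcInsertion_comp {l m n : ℕ} (Y : Skein q m n) (Z : Skein q l m) :
    arcInsertion (comp Y Z) = comp (arcInsertion Y) (arcInsertion Z) := by
  simp only [arcInsertion_apply, ← tensor_comp, comp_one]

/-- The two values on classes are the product formulas with second factor `1₁`, since arc insertion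
is `- × 1₁`. The intertwining property is the functoriality of arc insertion. -/
theorem isLinkPatternTower_connecting : IsLinkPatternTower q 1 (connecting q) where
  even n h Y := by rw [connecting_apply, mul_bar_even_odd, arcInsertion_apply]
  odd n h Y := by rw [connecting_apply, mul_bar_odd_odd, arcInsertion_apply]
  intertwines n a y := by
    obtain ⟨Y, rfl⟩ := bar_surjective rfl y
    rw [act_bar, connecting_apply, connecting_apply, mul_bar rfl _ rfl, mul_bar rfl _ rfl,
      act_bar, ← arcInsertion_apply, ← arcInsertion_apply, arcInsertion_comp, comp_assoc]

/-- The prescribed values on even and odd classes already determine the maps, because `bar` is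
surjective. -/
theorem IsLinkPatternTower.eq_connecting {φ : ∀ n, V q 1 n →ₗ[ℂ] V q 1 (n + 1)}
    (h : IsLinkPatternTower q 1 φ) : φ = connecting q := by
  have s := isLinkPatternTower_connecting (q := q)
  funext n
  ext y
  rcases Nat.mod_two_eq_zero_or_one n with hn | hn <;> obtain ⟨Y, rfl⟩ := bar_surjective hn y
  · rw [h.even, s.even]
  · rw [h.odd, s.odd]

end AnnularSkein

theorem mainTheorem10 (q : ℂˣ) :
    (∃! φ : ∀ n, V q 1 n →ₗ[ℂ] V q 1 (n + 1), IsLinkPatternTower q 1 φ) ∧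
    (∃! μ : A q →ₗ[ℂ] A q →ₗ[ℂ] A q, IsSkeinProduct q μ) ∧
    ∀ (φ : ∀ n, V q 1 n →ₗ[ℂ] V q 1 (n + 1)) (μ : A q →ₗ[ℂ] A q →ₗ[ℂ] A q),
      IsLinkPatternTower q 1 φ → IsSkeinProduct q μ →
        (∀ x y z : A q, μ (μ x y) z = μ x (μ y z)) ∧
        (∀ x : A q, μ (incl q 0 (bar q 1 (e := 0) rfl (Skein.one q 0))) x = x ∧
          μ x (incl q 0 (bar q 1 (e := 0) rfl (Skein.one q 0))) = x) ∧
        ∀ (n : ℕ) (y : V q 1 n),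
          incl q (n + 1) (φ n y) = μ (incl q n y) (incl q 1 (bar q 1 (e := 1) rfl (Skein.one q 1))) := by
  refine ⟨⟨connecting q, isLinkPatternTower_connecting, fun φ h => h.eq_connecting⟩,
    ⟨skeinProduct q, isSkeinProduct_skeinProduct, fun μ h => h.eq_skeinProduct⟩,
    fun φ μ hφ hμ => ?_⟩
  obtain rfl := hφ.eq_connecting
  obtain rfl := hμ.eq_skeinProduct
  exact ⟨skeinProduct_assoc, fun x => ⟨skeinProduct_one_left x, skeinProduct_one_right x⟩,
    fun n y => by rw [connecting_apply, skeinProduct_incl]⟩
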